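/- Let $n$ be a natural number with $2n+1>3$ and let $M$ be a connected smooth manifold of dimension $2n+1$ with a para-Sasakian structure $(\varphi,\xi,\eta,g)$. That is: $\varphi$ is a smooth $(1,1)$-tensor field, $\xi$ a smooth vector field, $\eta$ a smooth $1$-form and $g$ a smooth pseudo-Riemannian metric with $\varphi^2=\mathrm{Id}-\eta\otimes\xi$ and $\eta(\xi)=1$; the $(+1)$- and $(-1)$-eigenspaces of $\varphi$ on $\ker\eta$ both have dimension $n$ at every point; $g(\varphi X,\varphi Y)=-g(X,Y)+\eta(X)\eta(Y)$; $d\eta(X,Y)=g(X,\varphi Y)$, where $d\eta(X,Y)=\frac12\big(X\eta(Y)-Y\eta(X)-\eta([X,Y])\big)$; and $[\varphi,\varphi](X,Y)-2\,d\eta(X,Y)\,\xi=0$, where $[\varphi,\varphi](X,Y)=\varphi^2[X,Y]+[\varphi X,\varphi Y]-\varphi[X,\varphi Y]-\varphi[\varphi X,Y]$. Let $S$ be the Ricci tensor of $g$, $Q$ the Ricci operator, $g(QX,Y)=S(X,Y)$, and $r=\operatorname{tr}Q$ the scalar curvature. Suppose that $g$ is a gradient almost conformal $\eta$-Ricci soliton: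 there are smooth functions $f,\lambda,\mu,p:M\to\mathbb R$ such that the gradient of $f$ does not vanish identically and $$\mathrm{Hess}\,f+S+\Big[\lambda-\Big(\frac p2+\frac1{2n+1}\Big)\Big]g+\mu\,\eta\otimes\eta=0 .$$ Then $\mu\equiv0$, so that the soliton is a gradient almost conformal Ricci soliton, $$\mathrm{Hess}\,f+S+\Big[\lambda-\Big(\frac p2+\frac1{2n+1}\Big)\Big]g=0 ,$$ and $M$ is Einstein with $S=-2n\,g$, that is $Q=-2n\,\mathrm{Id}$, and $r=-2n(2n+1)$. -/

import Mathlib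

open scoped Manifold ContDiff

noncomputable section

namespace ParaSasaki

/-! ## Tensor calculus in coordinates

`Coord m` is the coordinate space `ℝ^m`. Tensor fields on an open subset of it are functions on
`Coord m`, used only on that open subset. -/

/-- The coordinate space `ℝ^m`. -/
abbrev Coord (m : ℕ) : Type := EuclideanSpace ℝ (Fin m)

section Coordinates

variable {m : ℕ}

/-- The `i`-th coordinate vector. -/
def coordVec (i : Fin m) : Coord m := EuclideanSpace.single i 1

/-- The differential of a one-form `η`, with the convention
`dη(X, Y) = ½ (X η(Y) - Y η(X) - η([X, Y]))`. -/
def extDeriv1 (η : Coord m → Coord m →L[ℝ] ℝ) (X Y : Coord m → Coord m) (y : Coord m) : ℝ :=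
  (1 / 2) * (fderiv ℝ (fun z => η z (Y z)) y (X y) - fderiv ℝ (fun z => η z (X z)) y (Y y)
    - η y (VectorField.lieBracket ℝ X Y y))

/-- `[φ, φ](X, Y) = φ²[X, Y] + [φX, φY] - φ[X, φY] - φ[φX, Y]`. -/
def nijenhuis (φ : Coord m → Coord m →L[ℝ] Coord m) (X Y : Coord m → Coord m) (y : Coord m) :
    Coord m :=
  φ y (φ y (VectorField.lieBracket ℝ X Y y))
    + VectorField.lieBracket ℝ (fun z => φ z (X z)) (fun z => φ z (Y z)) y
    - φ y (VectorField.lieBracket ℝ X (fun z => φ z (Y z)) y)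
    - φ y (VectorField.lieBracket ℝ (fun z => φ z (X z)) Y y)

/-- Christoffel symbols of the first kind of a metric `g`: the linear form
`z ↦ ½ (∂_u g(v, z) + ∂_v g(u, z) - ∂_z g(u, v))`. -/
def christoffelFirst (g : Coord m → Coord m →L[ℝ] Coord m →L[ℝ] ℝ) (y u v : Coord m) :
    Coord m →L[ℝ] ℝ :=
  (1 / 2 : ℝ) • (fderiv ℝ g y u v + fderiv ℝ g y v u - ((fderiv ℝ g y).flip u).flip v)

/-- Christoffel symbols of the second kind: the vector `Γ(u, v)` with
`g(Γ(u, v), z) = ½ (∂_u g(v, z) + ∂_v g(u, z) - ∂_z g(u, v))` for all `z`. -/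
def christoffel (g : Coord m → Coord m →L[ℝ] Coord m →L[ℝ] ℝ) (y u v : Coord m) : Coord m :=
  (g y).inverse (christoffelFirst g y u v)

/-- The Levi-Civita covariant derivative `∇_X Y` of the metric `g`. -/
def covDeriv (g : Coord m → Coord m →L[ℝ] Coord m →L[ℝ] ℝ) (X Y : Coord m → Coord m)
    (y : Coord m) : Coord m :=
  fderiv ℝ Y y (X y) + christoffel g y (X y) (Y y)

/-- The curvature tensor `R(u, v) w = ∇_u ∇_v w - ∇_v ∇_u w - ∇_[u, v] w`, computed with the
extensions of the vectors `u`, `v`, `w` to constant vector fields, for which `[u, v] = 0`. -/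
def curvature (g : Coord m → Coord m →L[ℝ] Coord m →L[ℝ] ℝ) (y u v w : Coord m) : Coord m :=
  covDeriv g (fun _ => u) (covDeriv g (fun _ => v) (fun _ => w)) y
    - covDeriv g (fun _ => v) (covDeriv g (fun _ => u) (fun _ => w)) y

/-- The Ricci tensor `S(v, w) = tr (u ↦ R(u, v) w)`. -/
def ricci (g : Coord m → Coord m →L[ℝ] Coord m →L[ℝ] ℝ) (y v w : Coord m) : ℝ :=
  ∑ i, (curvature g y (coordVec i) v w) i

/-- The Ricci operator, `g(Q v, w) = S(v, w)`. In coordinates, `(Q v)^i = ∑ j, g^{ij} S(v, ∂_j)`;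
the `j`-th summand below is `S(v, ∂_j)` times the vector which `g` makes dual to `dx^j`. -/
def ricciOp (g : Coord m → Coord m →L[ℝ] Coord m →L[ℝ] ℝ) (y v : Coord m) : Coord m :=
  ∑ j, ricci g y v (coordVec j) • (g y).inverse (EuclideanSpace.proj j)

/-- The scalar curvature `r = tr Q`. -/
def scalarCurvature (g : Coord m → Coord m →L[ℝ] Coord m →L[ℝ] ℝ) (y : Coord m) : ℝ :=
  ∑ i, (ricciOp g y (coordVec i)) i

/-- The Hessian `(Hess f)(u, v) = u (v f) - (∇_u v) f`, with `v` extended to a constant vector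
field. -/
def hessian (g : Coord m → Coord m →L[ℝ] Coord m →L[ℝ] ℝ) (f : Coord m → ℝ) (y u v : Coord m) :
    ℝ :=
  fderiv ℝ (fun z => fderiv ℝ f z v) y u - fderiv ℝ f y (covDeriv g (fun _ => u) (fun _ => v) y)

end Coordinates

/-! ## Reading tensor fields of a manifold in charts -/

section Charts

variable {m : ℕ} {M : Type*} [TopologicalSpace M] [ChartedSpace (Coord m) M]

/-- The set of coordinate values of the chart around `c`. -/
def chartDomain (c : M) : Set (Coord m) := (extChartAt (𝓡 m) c).target

/-- The point of `M` with coordinates `y` in the chart around `c`. -/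
def chartPoint (c : M) (y : Coord m) : M := (extChartAt (𝓡 m) c).symm y

/-- The tangent vector of `M` with given components in the chart around `c`. -/
def fromCoord (c : M) (y : Coord m) : Coord m →L[ℝ] TangentSpace (𝓡 m) (chartPoint c y) :=
  mfderiv 𝓘(ℝ, Coord m) (𝓡 m) (extChartAt (𝓡 m) c).symm y

/-- The components in the chart around `c` of a tangent vector of `M`. -/
def toCoord (c : M) (y : Coord m) : TangentSpace (𝓡 m) (chartPoint c y) →L[ℝ] Coord m :=
  mfderiv (𝓡 m) 𝓘(ℝ, Coord m) (extChartAt (𝓡 m) c) (chartPoint c y)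

/-- A function in the chart around `c`. -/
def readFun (c : M) (f : M → ℝ) (y : Coord m) : ℝ := f (chartPoint c y)

/-- A vector field in the chart around `c`. -/
def readVec (c : M) (ξ : ∀ x : M, TangentSpace (𝓡 m) x) (y : Coord m) : Coord m :=
  toCoord c y (ξ (chartPoint c y))

/-- A one-form in the chart around `c`. -/
def readForm (c : M) (η : ∀ x : M, TangentSpace (𝓡 m) x →L[ℝ] ℝ) (y : Coord m) :
    Coord m →L[ℝ] ℝ :=
  (η (chartPoint c y)).comp (fromCoord c y)

/-- A `(1,1)`-tensor field in the chart around `c`. -/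
def readEnd (c : M) (φ : ∀ x : M, TangentSpace (𝓡 m) x →L[ℝ] TangentSpace (𝓡 m) x)
    (y : Coord m) : Coord m →L[ℝ] Coord m :=
  (toCoord c y).comp ((φ (chartPoint c y)).comp (fromCoord c y))

/-- A `(0,2)`-tensor field in the chart around `c`. -/
def readBilin (c : M) (g : ∀ x : M, TangentSpace (𝓡 m) x →L[ℝ] TangentSpace (𝓡 m) x →L[ℝ] ℝ)
    (y : Coord m) : Coord m →L[ℝ] Coord m →L[ℝ] ℝ :=
  (ContinuousLinearMap.precomp ℝ (fromCoord c y)).comp ((g (chartPoint c y)).comp (fromCoord c y))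

end Charts

/-! ## Para-Sasakian manifolds -/

/-- An almost paracontact metric structure `(φ, ξ, η, g)` on a smooth manifold `M` of dimension
`2n + 1`, with `g` a pseudo-Riemannian metric. -/
structure AlmostParacontactMetric (n : ℕ) (M : Type*) [TopologicalSpace M]
    [ChartedSpace (Coord (2 * n + 1)) M] [IsManifold (𝓡 (2 * n + 1)) ∞ M] where
  /-- the tensor field of type `(1,1)` -/
  φ : ∀ x : M, TangentSpace (𝓡 (2 * n + 1)) x →L[ℝ] TangentSpace (𝓡 (2 * n + 1)) x
  /-- the characteristic vector field -/
  ξ : ∀ x : M, TangentSpace (𝓡 (2 * n + 1)) x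
  /-- the one-form -/
  η : ∀ x : M, TangentSpace (𝓡 (2 * n + 1)) x →L[ℝ] ℝ
  /-- the pseudo-Riemannian metric -/
  g : ∀ x : M, TangentSpace (𝓡 (2 * n + 1)) x →L[ℝ] TangentSpace (𝓡 (2 * n + 1)) x →L[ℝ] ℝ
  smooth_φ : ContMDiff (𝓡 (2 * n + 1))
    ((𝓡 (2 * n + 1)).prod 𝓘(ℝ, Coord (2 * n + 1) →L[ℝ] Coord (2 * n + 1))) ∞
    (fun x => Bundle.TotalSpace.mk' (Coord (2 * n + 1) →L[ℝ] Coord (2 * n + 1))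
      (E := fun x : M => TangentSpace (𝓡 (2 * n + 1)) x →L[ℝ] TangentSpace (𝓡 (2 * n + 1)) x)
      x (φ x))
  smooth_ξ : ContMDiff (𝓡 (2 * n + 1)) (𝓡 (2 * n + 1)).tangent ∞
    (fun x => (⟨x, ξ x⟩ : TangentBundle (𝓡 (2 * n + 1)) M))
  smooth_η : ContMDiff (𝓡 (2 * n + 1))
    ((𝓡 (2 * n + 1)).prod 𝓘(ℝ, Coord (2 * n + 1) →L[ℝ] ℝ)) ∞
    (fun x => Bundle.TotalSpace.mk' (Coord (2 * n + 1) →L[ℝ] ℝ)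
      (E := fun x : M => TangentSpace (𝓡 (2 * n + 1)) x →L[ℝ] ℝ) x (η x))
  smooth_g : ContMDiff (𝓡 (2 * n + 1))
    ((𝓡 (2 * n + 1)).prod 𝓘(ℝ, Coord (2 * n + 1) →L[ℝ] Coord (2 * n + 1) →L[ℝ] ℝ)) ∞
    (fun x => Bundle.TotalSpace.mk' (Coord (2 * n + 1) →L[ℝ] Coord (2 * n + 1) →L[ℝ] ℝ)
      (E := fun x : M =>
        TangentSpace (𝓡 (2 * n + 1)) x →L[ℝ] TangentSpace (𝓡 (2 * n + 1)) x →L[ℝ] ℝ) x (g x))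
  phi_sq : ∀ x u, φ x (φ x u) = u - η x u • ξ x
  eta_xi : ∀ x, η x (ξ x) = 1
  /-- the `+1`-eigenspace of `φ` on `ker η` has dimension `n` -/
  finrank_plus : ∀ x, Module.finrank ℝ
    ↥(Module.End.eigenspace (φ x).toLinearMap 1 ⊓ LinearMap.ker (η x).toLinearMap) = n
  /-- the `-1`-eigenspace of `φ` on `ker η` has dimension `n` -/
  finrank_minus : ∀ x, Module.finrank ℝ
    ↥(Module.End.eigenspace (φ x).toLinearMap (-1) ⊓ LinearMap.ker (η x).toLinearMap) = n
  g_symm : ∀ x u v, g x u v = g x v u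
  g_nondegenerate : ∀ x u, (∀ v, g x u v = 0) → u = 0
  /-- compatibility of the metric with the almost paracontact structure -/
  g_compat : ∀ x u v, g x (φ x u) (φ x v) = - g x u v + η x u * η x v

section Structures

variable {n : ℕ} {M : Type*} [TopologicalSpace M] [ChartedSpace (Coord (2 * n + 1)) M]
  [IsManifold (𝓡 (2 * n + 1)) ∞ M]

/-- Paracontact metric structure: `dη(X, Y) = g(X, φ Y)` for all local vector fields. -/
def IsParacontactMetric (A : AlmostParacontactMetric n M) : Prop :=
  ∀ c : M, ∀ y ∈ chartDomain (m := 2 * n + 1) c, ∀ X Y : Coord (2 * n + 1) → Coord (2 * n + 1),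
    ContDiff ℝ ∞ X → ContDiff ℝ ∞ Y →
      extDeriv1 (readForm c A.η) X Y y = readBilin c A.g y (X y) (readEnd c A.φ y (Y y))

/-- Normality: `[φ, φ](X, Y) - 2 dη(X, Y) ξ = 0` for all local vector fields. -/
def IsNormal (A : AlmostParacontactMetric n M) : Prop :=
  ∀ c : M, ∀ y ∈ chartDomain (m := 2 * n + 1) c, ∀ X Y : Coord (2 * n + 1) → Coord (2 * n + 1),
    ContDiff ℝ ∞ X → ContDiff ℝ ∞ Y →
      nijenhuis (readEnd c A.φ) X Y y
        - (2 * extDeriv1 (readForm c A.η) X Y y) • readVec c A.ξ y = 0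

/-- A para-Sasakian structure is a normal paracontact metric structure. -/
structure IsParaSasakian (A : AlmostParacontactMetric n M) : Prop where
  paracontact : IsParacontactMetric A
  normal : IsNormal A

/-- `g` is a gradient almost conformal `η`-Ricci soliton with potential function `f`, soliton
functions `lam`, `mu` and scalar field `p`: the potential field `Df` is not identically zero, and
`Hess f + S + [lam - (p/2 + 1/(2n+1))] g + mu η ⊗ η = 0`. -/
structure IsGradientAlmostConformalEtaRicciSoliton (A : AlmostParacontactMetric n M)
    (f lam mu p : M → ℝ) : Prop where
  smooth_f : ContMDiff (𝓡 (2 * n + 1)) 𝓘(ℝ, ℝ) ∞ f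
  smooth_lam : ContMDiff (𝓡 (2 * n + 1)) 𝓘(ℝ, ℝ) ∞ lam
  smooth_mu : ContMDiff (𝓡 (2 * n + 1)) 𝓘(ℝ, ℝ) ∞ mu
  smooth_p : ContMDiff (𝓡 (2 * n + 1)) 𝓘(ℝ, ℝ) ∞ p
  nonzero : ∃ x, mfderiv (𝓡 (2 * n + 1)) 𝓘(ℝ, ℝ) f x ≠ 0
  equation : ∀ c : M, ∀ y ∈ chartDomain (m := 2 * n + 1) c, ∀ u v : Coord (2 * n + 1),
    hessian (readBilin c A.g) (readFun c f) y u v + ricci (readBilin c A.g) y u v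
      + (readFun c lam y - (readFun c p y / 2 + 1 / (2 * (n : ℝ) + 1))) * readBilin c A.g y u v
      + readFun c mu y * (readForm c A.η y u * readForm c A.η y v) = 0

/-- `g` is a gradient almost conformal Ricci soliton:
`Df` is not identically zero and `Hess f + S + [lam - (p/2 + 1/(2n+1))] g = 0`. -/
structure IsGradientAlmostConformalRicciSoliton (A : AlmostParacontactMetric n M)
    (f lam p : M → ℝ) : Prop where
  smooth_f : ContMDiff (𝓡 (2 * n + 1)) 𝓘(ℝ, ℝ) ∞ f
  smooth_lam : ContMDiff (𝓡 (2 * n + 1)) 𝓘(ℝ, ℝ) ∞ lam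
  smooth_p : ContMDiff (𝓡 (2 * n + 1)) 𝓘(ℝ, ℝ) ∞ p
  nonzero : ∃ x, mfderiv (𝓡 (2 * n + 1)) 𝓘(ℝ, ℝ) f x ≠ 0
  equation : ∀ c : M, ∀ y ∈ chartDomain (m := 2 * n + 1) c, ∀ u v : Coord (2 * n + 1),
    hessian (readBilin c A.g) (readFun c f) y u v + ricci (readBilin c A.g) y u v
      + (readFun c lam y - (readFun c p y / 2 + 1 / (2 * (n : ℝ) + 1))) * readBilin c A.g y u v = 0

end Structures

end ParaSasaki

end

/-! Work in a chart, with m = 2n + 1 and a = λ - (p/2 + 1/(2n+1)). Closedness of dη and normality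
force ∇ξ = -φ and (∇_u φ)v = -g(u, v)ξ + η(v)u, by the argument that gives ∇J = 0 on a Kähler
manifold (`covDerivVec_eq`, `covDerivEnd_eq`). The Ricci identity then yields R(u, v)ξ and the
commutator of R(u, v) with φ; their traces are S(v, ξ) = -(m - 1)η(v) and the skewness of S(v, φw)
in v, w.

The soliton equation enters through the function ξf: its second derivatives commute, which expresses
S(u, φv) through g(u, φv) and d(a + μ + f) (`ricci_phi_eq`). At u = ξ this makes d(a + μ + f) a
multiple of η, and since dη ≠ 0 a closed multiple of η vanishes (`fderiv_potential`). What remains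
is S = (μ - (m - 1))g - μ η⊗η (`ricci_eq`), so the η⊗η terms cancel in the soliton equation and Hess
f = -c g with c = a + μ - (m - 1) and dc = -df. The Ricci identity for the gradient Df gives R(u,
v)Df = df(u)v - df(v)u; its trace, compared with the formula for S, is μ(df - (ξf)η) = 0
(`mu_mul_fderiv`).

Where μ ≠ 0, df is a multiple of η, hence df = 0 and c = 0 there. But (df, c) solves the linear
first-order system ∇df = -c g, dc = -df, so this vanishing spreads over the connected manifold
(`eventually_fderiv_eq_zero`), against the hypothesis on f. So μ = 0, and the formula for S becomes
S = -2n g. -/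

noncomputable section

set_option maxSynthPendingDepth 3

namespace ParaSasaki

/-! ## Linear algebra of an almost paracontact metric structure at a point -/

section Pointwise

variable {E : Type*} [NormedAddCommGroup E] [NormedSpace ℝ E]

/-- An almost paracontact structure with compatible metric on a vector space. -/
structure IsPointwise (φ : E →L[ℝ] E) (ξ : E) (η : E →L[ℝ] ℝ) (g : E →L[ℝ] E →L[ℝ] ℝ) :
    Prop where
  phi_sq : ∀ u, φ (φ u) = u - η u • ξ
  eta_xi : η ξ = 1
  symm : ∀ u v, g u v = g v u
  nondeg : ∀ u, (∀ v, g u v = 0) → u = 0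
  compat : ∀ u v, g (φ u) (φ v) = - g u v + η u * η v

namespace IsPointwise

variable {φ : E →L[ℝ] E} {ξ : E} {η : E →L[ℝ] ℝ} {g : E →L[ℝ] E →L[ℝ] ℝ}
  (h : IsPointwise φ ξ η g)

include h

theorem eq_of_forall {u v : E} (huv : ∀ w, g u w = g v w) : u = v :=
  sub_eq_zero.1 (h.nondeg _ fun w => by simp [huv w])

theorem phi_xi : φ ξ = 0 := by
  have h1 : φ (φ ξ) = 0 := by simp [h.phi_sq, h.eta_xi]
  have h2 := h.phi_sq (φ ξ)
  rw [h1, map_zero] at h2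
  have h3 : φ ξ = η (φ ξ) • ξ := (sub_eq_zero.1 h2.symm)
  have h4 : η (φ ξ) • φ ξ = 0 := by rw [← map_smul, ← h3, h1]
  rcases smul_eq_zero.1 h4 with h5 | h5
  · rw [h3, h5, zero_smul]
  · exact h5

theorem eta_phi (u : E) : η (φ u) = 0 := by
  have h1 : φ (φ (φ u)) = φ u := by rw [h.phi_sq u]; simp [h.phi_xi]
  have h2 := h.phi_sq (φ u)
  rw [h1, eq_sub_iff_add_eq, add_eq_left] at h2
  have h3 := congrArg η h2
  simpa [h.eta_xi] using h3

theorem g_xi (u : E) : g u ξ = η u := by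
  have := h.compat u ξ
  rw [h.phi_xi, map_zero, h.eta_xi] at this
  linarith

theorem xi_g (u : E) : g ξ u = η u := by rw [h.symm, h.g_xi]

theorem g_phi (u v : E) : g u (φ v) = - g (φ u) v := by
  have := h.compat u (φ v)
  rw [h.phi_sq, h.eta_phi, map_sub, map_smul, h.g_xi, h.eta_phi] at this
  simp at this
  linarith

theorem g_phi_comm (u v : E) : g u (φ v) = - g v (φ u) := by
  rw [h.g_phi, h.symm]

theorem g_phi_phi (u v : E) : g u (φ (φ v)) = g u v - η u * η v := by
  rw [h.phi_sq, map_sub, map_smul, h.g_xi, smul_eq_mul, mul_comm]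

/-- The covariant derivative of the characteristic vector field is `-φ`. -/
theorem nabla_xi {Ψ : E →L[ℝ] E →L[ℝ] E} {N : E →L[ℝ] E}
    (cyc : ∀ u v w, g (Ψ u v) w + g (Ψ v w) u + g (Ψ w u) v = 0)
    (normal : ∀ u v, Ψ (φ u) v - Ψ (φ v) u - φ (Ψ u v) + φ (Ψ v u) = (2 * g u (φ v)) • ξ)
    (Ψξ : ∀ u, Ψ u ξ = - φ (N u)) (skew : ∀ u v w, g (Ψ u v) w = - g v (Ψ u w))
    (Nξ : ∀ u, g (N u) ξ = 0)
    (d_eta : ∀ u v, g (N u) v - g (N v) u = 2 * g u (φ v)) (u : E) : N u = - φ u := by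
  have Ψξ' : ∀ u w, g (Ψ u ξ) w = g (N u) (φ w) := by
    intro u w; rw [Ψξ, h.g_phi]; simp
  have Ψξ'' : ∀ u w, g (Ψ u w) ξ = - g (N u) (φ w) := by
    intro u w; rw [skew, h.symm, Ψξ']
  have hφφ : ∀ u w, g (N u) (φ (φ w)) = g (N u) w := by
    intro u w; rw [h.phi_sq, map_sub, map_smul, Nξ]; simp
  -- Normality at (ξ, y) and closedness at (ξ, y, φz) share the term g((∇_ξ φ)y, φz). Eliminating it
  -- shows that the symmetric part of ∇ξ vanishes on the image of φ. With ∇_ξ ξ = 0 this makes ξ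
  -- Killing, and dη supplies the skew part.
  have s1 : ∀ y z, g (N (φ y)) (φ z) + g (N (φ z)) (φ y) = 0 := by
    intro y z
    have n1 := congrArg (fun x => g x z) (normal ξ y)
    simp only [h.phi_xi, map_zero, map_add, map_sub, map_smul, add_apply,
      sub_apply, zero_apply, smul_apply,
      smul_eq_mul, h.xi_g, h.eta_phi, mul_zero, zero_mul] at n1
    have e1 : ∀ x, g (φ x) z = - g x (φ z) := fun x => by rw [h.g_phi]; ring
    rw [e1, e1, Ψξ', Ψξ', hφφ] at n1
    have c1 := cyc ξ y (φ z)
    rw [Ψξ'', Ψξ', hφφ] at c1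
    linarith
  have s2 : ∀ z, g (N ξ) z = 0 := by
    intro z
    have := d_eta ξ z
    rw [Nξ, h.xi_g, h.eta_phi] at this
    linarith
  have s3 : ∀ y z, g (N y) z + g (N z) y = 0 := by
    intro y z
    have := s1 (φ y) (φ z)
    rw [h.phi_sq, h.phi_sq, map_sub, map_sub, map_smul, map_smul] at this
    simp only [map_sub, map_smul, sub_apply, smul_apply,
      s2, Nξ, smul_eq_mul] at this
    linarith
  refine h.eq_of_forall fun v => ?_
  have h1 := s3 u v
  have h2 := d_eta u v
  rw [h.g_phi] at h2
  simp
  linarith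

/-- The covariant derivative of `φ`. -/
theorem nabla_phi {Ψ : E →L[ℝ] E →L[ℝ] E} {N : E →L[ℝ] E}
    (cyc : ∀ u v w, g (Ψ u v) w + g (Ψ v w) u + g (Ψ w u) v = 0)
    (normal : ∀ u v, Ψ (φ u) v - Ψ (φ v) u - φ (Ψ u v) + φ (Ψ v u) = (2 * g u (φ v)) • ξ)
    (Ψξ : ∀ u, Ψ u ξ = - φ (N u)) (skew : ∀ u v w, g (Ψ u v) w = - g v (Ψ u w))
    (Ψφ : ∀ u v, Ψ u (φ v) + φ (Ψ u v) = - g (N u) v • ξ - η v • N u)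
    (hN : ∀ u, N u = - φ u) (u v : E) :
    Ψ u v = - g u v • ξ + η v • u := by
  have Ψξ' : ∀ u w, g (Ψ u ξ) w = g u w - η u * η w := by
    intro u w; rw [Ψξ, hN, map_neg φ, neg_neg, h.phi_sq]; simp [h.xi_g]
  have skew' : ∀ u v w, g (Ψ u v) w = - g (Ψ u w) v := by
    intro u v w; rw [skew, h.symm]
  -- The analogue of the Kähler computation: normality at (x, y) paired with z, closedness at (φx,
  -- y, z) and (φy, x, z), and `A`, the derivative of φ² = Id - η⊗ξ, form a linear system whose
  -- solution is this value.
  have key : ∀ x y z, g (Ψ z x) (φ y) = g z (φ y) * η x := by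
    intro x y z
    have e1 : ∀ x w, g (φ x) w = - g x (φ w) := fun x w => by rw [h.g_phi]; ring
    have A : ∀ u v w, g (Ψ u (φ v)) w - g (Ψ u v) (φ w)
        = - g u (φ v) * η w - η v * g u (φ w) := by
      intro u v w
      have := congrArg (fun x => g x w) (Ψφ u v)
      simp only [hN, map_add, map_sub, map_smul, map_neg, add_apply,
        sub_apply, neg_apply,
        smul_apply, smul_eq_mul, h.xi_g, e1] at this
      linarith
    have n1 := congrArg (fun t => g t z) (normal x y)
    simp only [map_add, map_sub, map_smul, add_apply,
      sub_apply, smul_apply,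
      smul_eq_mul, h.xi_g, e1] at n1
    have c1 := cyc (φ x) y z
    have c2 := cyc (φ y) x z
    have a1 := A z x y
    have a2 := A x y z
    have a3 := A y z x
    have a4 := A x z y
    have a5 := A y x z
    have b1 := skew' z x (φ y)
    have b2 := skew' z y (φ x)
    have b3 := skew' x y (φ z)
    have b4 := skew' y x (φ z)
    have b5 := skew' x z (φ y)
    have b6 := skew' y z (φ x)
    have d1 := congrArg (· * η z) (h.g_phi_comm x y)
    have d2 := congrArg (· * η y) (h.g_phi_comm x z)
    have d3 := congrArg (· * η x) (h.g_phi_comm y z)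
    linarith
  refine h.eq_of_forall fun w => ?_
  have e2 : w = φ (φ w) + η w • ξ := by rw [h.phi_sq]; abel
  have e3 : g (Ψ u v) w = g (Ψ u v) (φ (φ w)) + η w * g (Ψ u v) ξ := by
    conv_lhs => rw [e2]
    simp
  rw [e3, key, skew' u v ξ, Ψξ', h.g_phi_phi]
  simp [h.xi_g]
  ring

/-- If φ vanished, φ² = Id - η⊗ξ would make every vector a multiple of ξ. This is the nondegeneracy
of dη used later, and the place where the dimension matters. -/
theorem exists_g_phi_ne_zero [FiniteDimensional ℝ E] (hE : 1 < Module.finrank ℝ E) :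
    ∃ u v, g u (φ v) ≠ 0 := by
  by_contra! H
  have h1 : ∀ v, φ v = 0 := fun v => h.nondeg _ fun u => by rw [h.symm, H]
  have h2 : ∀ u, η u • ξ = u := fun u => by
    have := h.phi_sq u
    rw [h1] at this
    exact (sub_eq_zero.1 this.symm).symm
  have := finrank_le_one (R := ℝ) ξ fun w => ⟨η w, h2 w⟩
  omega

end IsPointwise

/-- The isomorphism u ↦ g(u, ·) onto the dual conjugates `B` to the transpose of `A`. No
definiteness of g is needed. -/
theorem trace_eq_of_adjoint [FiniteDimensional ℝ E] {g : E →L[ℝ] E →L[ℝ] ℝ}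
    (symm : ∀ u v, g u v = g v u) (nondeg : ∀ u, (∀ v, g u v = 0) → u = 0)
    {A B : E →ₗ[ℝ] E} (hAB : ∀ u v, g (A u) v = g u (B v)) :
    LinearMap.trace ℝ E A = LinearMap.trace ℝ E B := by
  let G₀ : E →ₗ[ℝ] Module.Dual ℝ E :=
    { toFun := fun u => (g u).toLinearMap
      map_add' := fun u v => by ext; simp
      map_smul' := fun c u => by ext; simp }
  have hinj : Function.Injective G₀ := by
    rw [injective_iff_map_eq_zero]
    intro u hu
    exact nondeg u fun v => LinearMap.congr_fun hu v
  let G : E ≃ₗ[ℝ] Module.Dual ℝ E :=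
    LinearEquiv.ofInjectiveOfFinrankEq G₀ hinj Subspace.dual_finrank_eq.symm
  have hG : ∀ u v, G u v = g u v := fun u v => rfl
  have hc : G.conj B = Module.Dual.transpose A := by
    ext l v
    obtain ⟨u, rfl⟩ := G.surjective l
    simp only [LinearEquiv.conj_apply_apply, LinearEquiv.symm_apply_apply, Module.Dual.transpose_apply, hG,
      LinearMap.comp_apply]
    rw [symm, ← hAB, symm]
  rw [← LinearMap.trace_transpose', ← hc, LinearMap.trace_conj']

end Pointwise

/-! ## The Levi-Civita connection and its curvature in coordinates -/

open scoped Topology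

/-- The device for differentiating a tensor identity valid on an open set: compute the derivative of
each side separately and equate. -/
theorem hasFDerivAt_apply_eq {E F : Type*} [NormedAddCommGroup E] [NormedSpace ℝ E]
    [NormedAddCommGroup F] [NormedSpace ℝ F] {U : Set E} {y : E} (hU : IsOpen U) (hy : y ∈ U)
    {f f' : E → F} {L L' : E →L[ℝ] F} (hff' : ∀ z ∈ U, f z = f' z)
    (hf : HasFDerivAt f L y) (hf' : HasFDerivAt f' L' y) (u : E) : L u = L' u := by
  have h : f =ᶠ[𝓝 y] f' := by filter_upwards [hU.mem_nhds hy] with z hz using hff' z hz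
  rw [(hf.congr_of_eventuallyEq h.symm).unique hf']

theorem _root_.ContDiffOn.fderiv_fderiv_comm {E F : Type*} [NormedAddCommGroup E] [NormedSpace ℝ E]
    [NormedAddCommGroup F] [NormedSpace ℝ F] {U : Set E} {f : E → F} (hf : ContDiffOn ℝ ∞ f U)
    (hU : IsOpen U) {y : E} (hy : y ∈ U) (u v : E) :
    fderiv ℝ (fderiv ℝ f) y u v = fderiv ℝ (fderiv ℝ f) y v u :=
  ((hf.contDiffAt (hU.mem_nhds hy)).isSymmSndFDerivAt
    (by simpa using ENat.LEInfty.out)).eq u v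

theorem _root_.ContDiffOn.hasFDerivAt_of_isOpen {E F : Type*} [NormedAddCommGroup E]
    [NormedSpace ℝ E] [NormedAddCommGroup F] [NormedSpace ℝ F] {U : Set E} {f : E → F}
    (hf : ContDiffOn ℝ ∞ f U) (hU : IsOpen U) {y : E} (hy : y ∈ U) :
    HasFDerivAt f (fderiv ℝ f y) y :=
  ((hf.contDiffAt (hU.mem_nhds hy)).differentiableAt (by simp)).hasFDerivAt

theorem _root_.ContDiffOn.fderiv_infty {E F : Type*} [NormedAddCommGroup E]
    [NormedSpace ℝ E] [NormedAddCommGroup F] [NormedSpace ℝ F] {U : Set E} {f : E → F}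
    (hf : ContDiffOn ℝ ∞ f U) (hU : IsOpen U) : ContDiffOn ℝ ∞ (fderiv ℝ f) U :=
  hf.fderiv_of_isOpen hU (by simp)

section Connection

variable {m : ℕ}

/-- Christoffel symbols of the first kind as a trilinear map. -/
def christoffelFirstMap (g : Coord m → Coord m →L[ℝ] Coord m →L[ℝ] ℝ) (y : Coord m) :
    Coord m →L[ℝ] Coord m →L[ℝ] Coord m →L[ℝ] ℝ :=
  (1 / 2 : ℝ) • (fderiv ℝ g y + (fderiv ℝ g y).flip
    - (ContinuousLinearMap.flipₗᵢ ℝ (Coord m) (Coord m) ℝ).toContinuousLinearEquiv.toContinuousLinearMap.comp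
      (fderiv ℝ g y).flip)

/-- Christoffel symbols of the second kind as a bilinear map. -/
def christoffelMap (g : Coord m → Coord m →L[ℝ] Coord m →L[ℝ] ℝ) (y : Coord m) :
    Coord m →L[ℝ] Coord m →L[ℝ] Coord m :=
  (ContinuousLinearMap.compL ℝ (Coord m) (Coord m →L[ℝ] ℝ) (Coord m) (g y).inverse).comp
    (christoffelFirstMap g y)

/-- A pseudo-Riemannian metric on an open subset of the coordinate space. -/
structure IsMetricOn (g : Coord m → Coord m →L[ℝ] Coord m →L[ℝ] ℝ) (U : Set (Coord m)) :
    Prop where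
  isOpen : IsOpen U
  smooth : ContDiffOn ℝ ∞ g U
  symm : ∀ y ∈ U, ∀ u v, g y u v = g y v u
  nondeg : ∀ y ∈ U, ∀ u, (∀ v, g y u v = 0) → u = 0

theorem christoffelFirstMap_apply (g : Coord m → Coord m →L[ℝ] Coord m →L[ℝ] ℝ)
    (y u v : Coord m) : christoffelFirstMap g y u v = christoffelFirst g y u v := by
  ext w
  simp [christoffelFirstMap, christoffelFirst]

theorem christoffelMap_apply (g : Coord m → Coord m →L[ℝ] Coord m →L[ℝ] ℝ)
    (y u v : Coord m) : christoffelMap g y u v = christoffel g y u v := by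
  rw [christoffel, ← christoffelFirstMap_apply]; rfl

namespace IsMetricOn

variable {g : Coord m → Coord m →L[ℝ] Coord m →L[ℝ] ℝ} {U : Set (Coord m)} (hg : IsMetricOn g U)
  {y : Coord m} (hy : y ∈ U)

include hg hy

theorem isInvertible : (g y).IsInvertible := by
  have hinj : Function.Injective (g y).toLinearMap := by
    rw [injective_iff_map_eq_zero]
    exact fun u hu => hg.nondeg y hy u fun v => DFunLike.congr_fun hu v
  have hrank : Module.finrank ℝ (Coord m) = Module.finrank ℝ (Coord m →L[ℝ] ℝ) := by
    rw [← (LinearMap.toContinuousLinearMap (𝕜 := ℝ) (E := Coord m) (F' := ℝ)).finrank_eq]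
    exact Subspace.dual_finrank_eq.symm
  exact ⟨(LinearEquiv.ofInjectiveOfFinrankEq _ hinj hrank).toContinuousLinearEquiv, rfl⟩

theorem apply_inverse (l : Coord m →L[ℝ] ℝ) : g y ((g y).inverse l) = l := by
  obtain ⟨e, he⟩ := hg.isInvertible hy
  rw [← he]; simp

theorem inverse_apply (u : Coord m) : (g y).inverse (g y u) = u := by
  obtain ⟨e, he⟩ := hg.isInvertible hy
  rw [← he]; simp

theorem eq_of_forall {u v : Coord m} (h : ∀ w, g y u w = g y v w) : u = v :=
  sub_eq_zero.1 (hg.nondeg y hy _ fun w => by simp [h w])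

theorem g_christoffelMap (u v w : Coord m) : g y (christoffelMap g y u v) w
    = (1 / 2) * (fderiv ℝ g y u v w + fderiv ℝ g y v u w - fderiv ℝ g y w u v) := by
  rw [christoffelMap_apply, christoffel, hg.apply_inverse hy]
  simp [christoffelFirst]

theorem fderiv_symm (u v w : Coord m) : fderiv ℝ g y u v w = fderiv ℝ g y u w v := by
  have hd := hg.smooth.hasFDerivAt_of_isOpen hg.isOpen hy
  have := hasFDerivAt_apply_eq hg.isOpen hy (fun z hz => hg.symm z hz v w)
    ((hd.clm_apply (hasFDerivAt_const v y)).clm_apply (hasFDerivAt_const w y))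
    ((hd.clm_apply (hasFDerivAt_const w y)).clm_apply (hasFDerivAt_const v y)) u
  simpa using this

theorem christoffelMap_symm (u v : Coord m) :
    christoffelMap g y u v = christoffelMap g y v u := by
  refine hg.eq_of_forall hy fun w => ?_
  rw [hg.g_christoffelMap hy, hg.g_christoffelMap hy, hg.fderiv_symm hy w]
  ring

/-- The Levi-Civita connection is metric. -/
theorem fderiv_metric (u v w : Coord m) : fderiv ℝ g y u v w
    = g y (christoffelMap g y u v) w + g y v (christoffelMap g y u w) := by
  rw [hg.symm y hy v, hg.g_christoffelMap hy, hg.g_christoffelMap hy, hg.fderiv_symm hy u v w,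
    hg.fderiv_symm hy v u w, hg.fderiv_symm hy w u v]
  ring

omit hy in
theorem contDiffOn_christoffelMap : ContDiffOn ℝ ∞ (christoffelMap g) U := by
  have h1 : ContDiffOn ℝ ∞ (fderiv ℝ g) U := hg.smooth.fderiv_infty hg.isOpen
  have h2 : ContDiffOn ℝ ∞ (fun y => (g y).inverse) U := fun z hz =>
    ((hg.isInvertible hz).contDiffAt_map_inverse.comp z
      (hg.smooth.contDiffAt (hg.isOpen.mem_nhds hz))).contDiffWithinAt
  have h3 : ContDiffOn ℝ ∞ (fun y => (fderiv ℝ g y).flip) U :=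
    (ContinuousLinearMap.flipₗᵢ ℝ (Coord m) (Coord m) (Coord m →L[ℝ] ℝ)).contDiff.comp_contDiffOn h1
  have h4 : ContDiffOn ℝ ∞ (christoffelFirstMap g) U :=
    ((h1.add h3).sub (contDiffOn_const.clm_comp h3)).const_smul _
  exact ((ContinuousLinearMap.compL ℝ (Coord m) (Coord m →L[ℝ] ℝ)
    (Coord m)).contDiff.comp_contDiffOn h2).clm_comp h4

theorem hasFDerivAt_christoffelMap :
    HasFDerivAt (christoffelMap g) (fderiv ℝ (christoffelMap g) y) y :=
  hg.contDiffOn_christoffelMap.hasFDerivAt_of_isOpen hg.isOpen hy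

theorem curvature_eq (u v w : Coord m) : curvature g y u v w
    = fderiv ℝ (christoffelMap g) y u v w + christoffelMap g y u (christoffelMap g y v w)
      - fderiv ℝ (christoffelMap g) y v u w
      - christoffelMap g y v (christoffelMap g y u w) := by
  have h1 : ∀ v w : Coord m, covDeriv g (fun _ => v) (fun _ => w)
      = fun z => christoffelMap g z v w := by
    intro v w; ext1 z; simp [covDeriv, christoffelMap_apply]
  have h2 : ∀ u v w : Coord m, fderiv ℝ (fun z => christoffelMap g z v w) y u
      = fderiv ℝ (christoffelMap g) y u v w := by
    intro u v w
    rw [(((hg.hasFDerivAt_christoffelMap hy).clm_apply (hasFDerivAt_const v y)).clm_apply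
      (hasFDerivAt_const w y)).fderiv]
    simp
  rw [curvature, h1, h1, covDeriv, covDeriv, h2, h2, christoffelMap_apply, christoffelMap_apply,
    christoffelMap_apply, christoffelMap_apply]
  abel

/-- The Ricci identity for a vector field `Z` with covariant derivative `W`. -/
theorem curvature_eq_of_covDeriv {Z : Coord m → Coord m} {W : Coord m → Coord m → Coord m}
    {W' : Coord m → Coord m →L[ℝ] Coord m}
    (hZ : ContDiffOn ℝ ∞ Z U) (hW : ∀ v, HasFDerivAt (fun z => W z v) (W' v) y)
    (h : ∀ z ∈ U, ∀ v, fderiv ℝ Z z v + christoffelMap g z v (Z z) = W z v) (u v : Coord m) :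
    curvature g y u v (Z y) = W' v u + christoffelMap g y u (W y v)
      - W' u v - christoffelMap g y v (W y u) := by
  have hd := hZ.hasFDerivAt_of_isOpen hg.isOpen hy
  have hd2 := (hZ.fderiv_infty hg.isOpen).hasFDerivAt_of_isOpen hg.isOpen hy
  -- Differentiate ∇_v Z = W(v) along u for constant v; after skewing in u and v the second
  -- derivatives of Z cancel.
  have key : ∀ u v, fderiv ℝ (fderiv ℝ Z) y u v + fderiv ℝ (christoffelMap g) y u v (Z y)
      + christoffelMap g y v (fderiv ℝ Z y u) = W' v u := by
    intro u v
    have := hasFDerivAt_apply_eq hg.isOpen hy (fun z hz => h z hz v)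
      ((hd2.clm_apply (hasFDerivAt_const v y)).add
        (((hg.hasFDerivAt_christoffelMap hy).clm_apply (hasFDerivAt_const v y)).clm_apply hd))
      (hW v) u
    simp at this
    rw [← this]; abel
  rw [hg.curvature_eq hy, ← key, ← key, ← h y hy, ← h y hy,
    hZ.fderiv_fderiv_comm hg.isOpen hy u v]
  simp only [map_add]
  abel

omit hg hy in
theorem _root_.ParaSasaki.curvature_skew (g : Coord m → Coord m →L[ℝ] Coord m →L[ℝ] ℝ)
    (y u v w : Coord m) : curvature g y v u w = - curvature g y u v w := by
  rw [curvature, curvature]; abel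

theorem bianchi (u v w : Coord m) :
    curvature g y u v w + curvature g y v w u + curvature g y w u v = 0 := by
  have hs : ∀ u v w, fderiv ℝ (christoffelMap g) y u v w
      = fderiv ℝ (christoffelMap g) y u w v := by
    intro u v w
    have hd := hg.hasFDerivAt_christoffelMap hy
    have := hasFDerivAt_apply_eq hg.isOpen hy (fun z hz => hg.christoffelMap_symm hz v w)
      ((hd.clm_apply (hasFDerivAt_const v y)).clm_apply (hasFDerivAt_const w y))
      ((hd.clm_apply (hasFDerivAt_const w y)).clm_apply (hasFDerivAt_const v y)) u
    simpa using this
  simp only [hg.curvature_eq hy]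
  rw [hs u w v, hs v w u, hs w v u, hg.christoffelMap_symm hy w v, hg.christoffelMap_symm hy w u,
    hg.christoffelMap_symm hy v u]
  abel

/-- The second derivatives of g commute; expanding them through ∇g = 0 leaves exactly the curvature
terms. -/
theorem g_curvature_skew (u v w x : Coord m) :
    g y (curvature g y u v w) x = - g y (curvature g y u v x) w := by
  have hd := hg.smooth.hasFDerivAt_of_isOpen hg.isOpen hy
  have hd2 := (hg.smooth.fderiv_infty hg.isOpen).hasFDerivAt_of_isOpen hg.isOpen hy
  have hΓ := hg.hasFDerivAt_christoffelMap hy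
  have key : ∀ u v w x, fderiv ℝ (fderiv ℝ g) y u v w x
      = fderiv ℝ g y u (christoffelMap g y v w) x + g y (fderiv ℝ (christoffelMap g) y u v w) x
        + fderiv ℝ g y u w (christoffelMap g y v x)
        + g y w (fderiv ℝ (christoffelMap g) y u v x) := by
    intro u v w x
    have cw := hasFDerivAt_const (𝕜 := ℝ) w y
    have cx := hasFDerivAt_const (𝕜 := ℝ) x y
    have cv := hasFDerivAt_const (𝕜 := ℝ) v y
    have := hasFDerivAt_apply_eq hg.isOpen hy (fun z hz => hg.fderiv_metric hz v w x)
      (((hd2.clm_apply cv).clm_apply cw).clm_apply cx)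
      (((hd.clm_apply ((hΓ.clm_apply cv).clm_apply cw)).clm_apply cx).add
        ((hd.clm_apply cw).clm_apply ((hΓ.clm_apply cv).clm_apply cx))) u
    simp at this
    linarith
  have h1 := key u v w x
  have h2 := key v u w x
  rw [hg.smooth.fderiv_fderiv_comm hg.isOpen hy u v] at h1
  simp only [hg.fderiv_metric hy] at h1 h2
  rw [hg.symm y hy (curvature g y u v x), hg.curvature_eq hy, hg.curvature_eq hy]
  simp only [map_add, map_sub, sub_apply, add_apply]
  linarith

/-- Pure algebra: a combination of Bianchi identities over the four cyclic orders, reduced by the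
two skew-symmetries. -/
theorem g_curvature_pair (u v w x : Coord m) :
    g y (curvature g y u v w) x = g y (curvature g y w x u) v := by
  have B : ∀ u v w x, g y (curvature g y u v w) x + g y (curvature g y v w u) x
      + g y (curvature g y w u v) x = 0 := by
    intro u v w x
    have := congrArg (fun t => g y t x) (hg.bianchi hy u v w)
    simpa using this
  have S : ∀ u v w x, g y (curvature g y u v w) x = - g y (curvature g y v u w) x := by
    intro u v w x
    rw [curvature_skew g y v u]; simp
  have T := hg.g_curvature_skew hy
  linarith [B u v w x, B v w x u, B w x u v, B x u v w, S u v w x, S v w u x, S w u v x,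
    T u v w x, T v w x u, S w x u v, T w x u v, T v w u x, T w u v x, T x u v w, S x v w u,
    S u x v w, T v x w u, T w u x v, T u v x w, S v x w u, T x v w u, T u x v w, S w u x v,
    T w x v u, S w x v u, S u v x w]

/-- The endomorphism `u ↦ R(u, v) w`. -/
def _root_.ParaSasaki.curvatureEnd (g : Coord m → Coord m →L[ℝ] Coord m →L[ℝ] ℝ)
    (y v w : Coord m) : Coord m →L[ℝ] Coord m :=
  ((fderiv ℝ (christoffelMap g) y).flip v).flip w + (christoffelMap g y).flip (christoffelMap g y v w)
    - (fderiv ℝ (christoffelMap g) y v).flip w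
    - (christoffelMap g y v).comp ((christoffelMap g y).flip w)

theorem curvatureEnd_apply (u v w : Coord m) : curvatureEnd g y v w u = curvature g y u v w := by
  rw [hg.curvature_eq hy]; rfl

theorem ricci_eq_trace (v w : Coord m) :
    ricci g y v w = LinearMap.trace ℝ (Coord m) (curvatureEnd g y v w).toLinearMap := by
  rw [LinearMap.trace_eq_sum_inner _ (EuclideanSpace.basisFun (Fin m) ℝ), ricci]
  refine Finset.sum_congr rfl fun i _ => ?_
  simp [hg.curvatureEnd_apply hy, coordVec, EuclideanSpace.inner_single_left]

/-- The Hessian in terms of second derivatives and Christoffel symbols. -/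
theorem hessian_eq (f : Coord m → ℝ) (hf : ContDiffOn ℝ ∞ f U) (u v : Coord m) :
    hessian g f y u v
      = fderiv ℝ (fderiv ℝ f) y u v - fderiv ℝ f y (christoffelMap g y u v) := by
  have hd2 := (hf.fderiv_infty hg.isOpen).hasFDerivAt_of_isOpen hg.isOpen hy
  rw [hessian, (hd2.clm_apply (hasFDerivAt_const v y)).fderiv]
  simp [covDeriv, christoffelMap_apply]

end IsMetricOn

end Connection

/-! ## Para-Sasakian structures in coordinates -/

section LocalParaSasakian

variable {m : ℕ}

/-- The covariant derivative of an endomorphism field. -/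
def covDerivEnd (g : Coord m → Coord m →L[ℝ] Coord m →L[ℝ] ℝ)
    (φ : Coord m → Coord m →L[ℝ] Coord m) (y : Coord m) : Coord m →L[ℝ] Coord m →L[ℝ] Coord m :=
  fderiv ℝ φ y
    + ((ContinuousLinearMap.compL ℝ (Coord m) (Coord m) (Coord m)).flip (φ y)).comp
      (christoffelMap g y)
    - ((ContinuousLinearMap.compL ℝ (Coord m) (Coord m) (Coord m)) (φ y)).comp
      (christoffelMap g y)

/-- The covariant derivative of a vector field. -/
def covDerivVec (g : Coord m → Coord m →L[ℝ] Coord m →L[ℝ] ℝ)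
    (ξ : Coord m → Coord m) (y : Coord m) : Coord m →L[ℝ] Coord m :=
  fderiv ℝ ξ y + (christoffelMap g y).flip (ξ y)

theorem fderiv_apply_eq_covDerivEnd (g : Coord m → Coord m →L[ℝ] Coord m →L[ℝ] ℝ)
    (φ : Coord m → Coord m →L[ℝ] Coord m) (y u w : Coord m) :
    fderiv ℝ φ y u w = covDerivEnd g φ y u w - christoffelMap g y u (φ y w)
      + φ y (christoffelMap g y u w) := by
  simp [covDerivEnd]
  abel

theorem fderiv_apply_eq_covDerivVec (g : Coord m → Coord m →L[ℝ] Coord m →L[ℝ] ℝ)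
    (ξ : Coord m → Coord m) (y u : Coord m) :
    fderiv ℝ ξ y u = covDerivVec g ξ y u - christoffelMap g y u (ξ y) := by
  simp [covDerivVec]

/-- A para-Sasakian structure on an open subset of the coordinate space. -/
structure IsParaSasakianOn (φ : Coord m → Coord m →L[ℝ] Coord m) (ξ : Coord m → Coord m)
    (η : Coord m → Coord m →L[ℝ] ℝ) (g : Coord m → Coord m →L[ℝ] Coord m →L[ℝ] ℝ)
    (U : Set (Coord m)) : Prop extends IsMetricOn g U where
  smooth_φ : ContDiffOn ℝ ∞ φ U
  smooth_ξ : ContDiffOn ℝ ∞ ξ U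
  smooth_η : ContDiffOn ℝ ∞ η U
  pointwise : ∀ y ∈ U, IsPointwise (φ y) (ξ y) (η y) (g y)
  d_eta : ∀ y ∈ U, ∀ u v, fderiv ℝ η y u v - fderiv ℝ η y v u = 2 * g y u (φ y v)
  normal : ∀ y ∈ U, ∀ u v, fderiv ℝ φ y (φ y u) v - fderiv ℝ φ y (φ y v) u
    - φ y (fderiv ℝ φ y u v) + φ y (fderiv ℝ φ y v u) = (2 * g y u (φ y v)) • ξ y

namespace IsParaSasakianOn

variable {φ : Coord m → Coord m →L[ℝ] Coord m} {ξ : Coord m → Coord m}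
  {η : Coord m → Coord m →L[ℝ] ℝ} {g : Coord m → Coord m →L[ℝ] Coord m →L[ℝ] ℝ}
  {U : Set (Coord m)} (h : IsParaSasakianOn φ ξ η g U)

include h

theorem mono {V : Set (Coord m)} (hV : IsOpen V) (hVU : V ⊆ U) : IsParaSasakianOn φ ξ η g V where
  isOpen := hV
  smooth := h.smooth.mono hVU
  symm y hy := h.symm y (hVU hy)
  nondeg y hy := h.nondeg y (hVU hy)
  smooth_φ := h.smooth_φ.mono hVU
  smooth_ξ := h.smooth_ξ.mono hVU
  smooth_η := h.smooth_η.mono hVU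
  pointwise y hy := h.pointwise y (hVU hy)
  d_eta y hy := h.d_eta y (hVU hy)
  normal y hy := h.normal y (hVU hy)

variable {y : Coord m} (hy : y ∈ U)

include hy

theorem hasFDerivAt_g : HasFDerivAt g (fderiv ℝ g y) y :=
  h.smooth.hasFDerivAt_of_isOpen h.isOpen hy

theorem hasFDerivAt_φ : HasFDerivAt φ (fderiv ℝ φ y) y :=
  h.smooth_φ.hasFDerivAt_of_isOpen h.isOpen hy

theorem hasFDerivAt_ξ : HasFDerivAt ξ (fderiv ℝ ξ y) y :=
  h.smooth_ξ.hasFDerivAt_of_isOpen h.isOpen hy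

theorem hasFDerivAt_η : HasFDerivAt η (fderiv ℝ η y) y :=
  h.smooth_η.hasFDerivAt_of_isOpen h.isOpen hy

theorem covDerivEnd_skew (u v w : Coord m) :
    g y (covDerivEnd g φ y u v) w = - g y v (covDerivEnd g φ y u w) := by
  have cv := hasFDerivAt_const (𝕜 := ℝ) v y
  have cw := hasFDerivAt_const (𝕜 := ℝ) w y
  have hg := h.hasFDerivAt_g hy
  have hφ := h.hasFDerivAt_φ hy
  have hp := h.pointwise y hy
  have := hasFDerivAt_apply_eq (f := fun z => g z v (φ z w) + g z (φ z v) w) (f' := fun _ => (0 : ℝ))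
    h.isOpen hy
    (fun z hz => by rw [(h.pointwise z hz).g_phi v w]; ring)
    (((hg.clm_apply cv).clm_apply (hφ.clm_apply cw)).add
      ((hg.clm_apply (hφ.clm_apply cv)).clm_apply cw)) (hasFDerivAt_const 0 y) u
  simp [h.fderiv_metric hy, fderiv_apply_eq_covDerivEnd g φ] at this
  linarith [hp.g_phi v (christoffelMap g y u w), hp.g_phi (christoffelMap g y u v) w]

/-- This is d(dη) = 0 for dη = g(·, φ·). In the cyclic sum the second derivatives of η cancel by
symmetry, and the Christoffel terms because the connection is torsion-free. -/
theorem covDerivEnd_cyclic (u v w : Coord m) :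
    g y (covDerivEnd g φ y u v) w + g y (covDerivEnd g φ y v w) u
      + g y (covDerivEnd g φ y w u) v = 0 := by
  have hg := h.hasFDerivAt_g hy
  have hφ := h.hasFDerivAt_φ hy
  have hη2 := (h.smooth_η.fderiv_infty h.isOpen).hasFDerivAt_of_isOpen h.isOpen hy
  have hp := h.pointwise y hy
  have key : ∀ u v w, fderiv ℝ (fderiv ℝ η) y u v w - fderiv ℝ (fderiv ℝ η) y u w v
      = 2 * (g y (christoffelMap g y u v) (φ y w) + g y v (covDerivEnd g φ y u w)
        + g y v (φ y (christoffelMap g y u w))) := by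
    intro u v w
    have cv := hasFDerivAt_const (𝕜 := ℝ) v y
    have cw := hasFDerivAt_const (𝕜 := ℝ) w y
    have := hasFDerivAt_apply_eq h.isOpen hy (fun z hz => h.d_eta z hz v w)
      (((hη2.clm_apply cv).clm_apply cw).sub ((hη2.clm_apply cw).clm_apply cv))
      (((hg.clm_apply cv).clm_apply (hφ.clm_apply cw)).const_mul 2) u
    simp [h.fderiv_metric hy, fderiv_apply_eq_covDerivEnd g φ] at this
    linarith
  have k1 := key u v w
  have k2 := key v w u
  have k3 := key w u v
  have c := fun u v => DFunLike.congr_fun (h.smooth_η.fderiv_fderiv_comm h.isOpen hy u v)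
  rw [c u v] at k1
  rw [c v w] at k2
  rw [c w u] at k3
  have s := h.covDerivEnd_skew hy
  have e := h.symm y hy
  have a1 := hp.g_phi_comm v (christoffelMap g y u w)
  have a2 := hp.g_phi_comm w (christoffelMap g y v u)
  have a3 := hp.g_phi_comm u (christoffelMap g y w v)
  rw [h.christoffelMap_symm hy u w] at a1 k1
  rw [h.christoffelMap_symm hy v u] at a2 k2
  rw [h.christoffelMap_symm hy w v] at a3 k3
  linarith [s u w v, s v u w, s w v u, e w (covDerivEnd g φ y u v),
    e u (covDerivEnd g φ y v w), e v (covDerivEnd g φ y w u), s u v w, s v w u, s w u v]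

/-- Torsion-freeness lets covariant derivatives replace partial ones in the Nijenhuis tensor. -/
theorem covDerivEnd_normal (u v : Coord m) :
    covDerivEnd g φ y (φ y u) v - covDerivEnd g φ y (φ y v) u - φ y (covDerivEnd g φ y u v)
      + φ y (covDerivEnd g φ y v u) = (2 * g y u (φ y v)) • ξ y := by
  have := h.normal y hy u v
  simp only [fderiv_apply_eq_covDerivEnd g φ, map_add, map_sub] at this
  rw [← this, h.christoffelMap_symm hy v u, h.christoffelMap_symm hy (φ y v) (φ y u),
    h.christoffelMap_symm hy (φ y v) u, h.christoffelMap_symm hy v (φ y u)]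
  abel

theorem fderiv_eta (u v : Coord m) :
    fderiv ℝ η y u v = g y (covDerivVec g ξ y u) v + η y (christoffelMap g y u v) := by
  have cv := hasFDerivAt_const (𝕜 := ℝ) v y
  have hp := h.pointwise y hy
  have := hasFDerivAt_apply_eq h.isOpen hy (fun z hz => ((h.pointwise z hz).xi_g v).symm)
    ((h.hasFDerivAt_η hy).clm_apply cv)
    (((h.hasFDerivAt_g hy).clm_apply (h.hasFDerivAt_ξ hy)).clm_apply cv) u
  simp [h.fderiv_metric hy, fderiv_apply_eq_covDerivVec g ξ, hp.xi_g] at this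
  linarith

theorem covDerivVec_d_eta (u v : Coord m) :
    g y (covDerivVec g ξ y u) v - g y (covDerivVec g ξ y v) u = 2 * g y u (φ y v) := by
  have := h.d_eta y hy u v
  rw [h.fderiv_eta hy, h.fderiv_eta hy, h.christoffelMap_symm hy v u] at this
  linarith

theorem g_covDerivVec_xi (u : Coord m) : g y (covDerivVec g ξ y u) (ξ y) = 0 := by
  have hp := h.pointwise y hy
  have := hasFDerivAt_apply_eq h.isOpen hy (fun z hz => (h.pointwise z hz).eta_xi)
    ((h.hasFDerivAt_η hy).clm_apply (h.hasFDerivAt_ξ hy)) (hasFDerivAt_const 1 y) u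
  simp [h.fderiv_eta hy, fderiv_apply_eq_covDerivVec g ξ, hp.g_xi] at this
  rw [hp.g_xi]
  linarith

theorem covDerivEnd_xi (u : Coord m) :
    covDerivEnd g φ y u (ξ y) = - φ y (covDerivVec g ξ y u) := by
  have hp := h.pointwise y hy
  have := hasFDerivAt_apply_eq h.isOpen hy (fun z hz => (h.pointwise z hz).phi_xi)
    ((h.hasFDerivAt_φ hy).clm_apply (h.hasFDerivAt_ξ hy)) (hasFDerivAt_const 0 y) u
  simp [fderiv_apply_eq_covDerivEnd g φ, fderiv_apply_eq_covDerivVec g ξ, hp.phi_xi] at this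
  rw [eq_neg_iff_add_eq_zero, ← this]
  abel

theorem covDerivEnd_phi (u v : Coord m) :
    covDerivEnd g φ y u (φ y v) + φ y (covDerivEnd g φ y u v)
      = - g y (covDerivVec g ξ y u) v • ξ y - η y v • covDerivVec g ξ y u := by
  have cv := hasFDerivAt_const (𝕜 := ℝ) v y
  have hφ := h.hasFDerivAt_φ hy
  have hp := h.pointwise y hy
  have := hasFDerivAt_apply_eq h.isOpen hy (fun z hz => (h.pointwise z hz).phi_sq v)
    (hφ.clm_apply (hφ.clm_apply cv))
    (cv.sub (((h.hasFDerivAt_η hy).clm_apply cv).smul (h.hasFDerivAt_ξ hy))) u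
  simp [fderiv_apply_eq_covDerivEnd g φ, fderiv_apply_eq_covDerivVec g ξ, h.fderiv_eta hy,
    hp.phi_sq] at this
  rw [← sub_eq_zero] at this ⊢
  rw [← this]
  module

/-- `∇ξ = -φ`. -/
theorem covDerivVec_eq (u : Coord m) : covDerivVec g ξ y u = - φ y u :=
  (h.pointwise y hy).nabla_xi (h.covDerivEnd_cyclic hy) (h.covDerivEnd_normal hy)
    (h.covDerivEnd_xi hy) (h.covDerivEnd_skew hy) (h.g_covDerivVec_xi hy) (h.covDerivVec_d_eta hy) u

/-- `(∇_u φ) v = -g(u, v) ξ + η(v) u`. -/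
theorem covDerivEnd_eq (u v : Coord m) :
    covDerivEnd g φ y u v = - g y u v • ξ y + η y v • u :=
  (h.pointwise y hy).nabla_phi (h.covDerivEnd_cyclic hy) (h.covDerivEnd_normal hy)
    (h.covDerivEnd_xi hy) (h.covDerivEnd_skew hy) (h.covDerivEnd_phi hy) (h.covDerivVec_eq hy) u v

theorem fderiv_phi (u v : Coord m) : fderiv ℝ φ y u v = - g y u v • ξ y + η y v • u
    - christoffelMap g y u (φ y v) + φ y (christoffelMap g y u v) := by
  rw [fderiv_apply_eq_covDerivEnd g φ, h.covDerivEnd_eq hy]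

theorem fderiv_xi (u : Coord m) : fderiv ℝ ξ y u = - φ y u - christoffelMap g y u (ξ y) := by
  rw [fderiv_apply_eq_covDerivVec g ξ, h.covDerivVec_eq hy]

theorem fderiv_eta_eq (u v : Coord m) :
    fderiv ℝ η y u v = g y u (φ y v) + η y (christoffelMap g y u v) := by
  rw [h.fderiv_eta hy, h.covDerivVec_eq hy, (h.pointwise y hy).g_phi]; simp

theorem curvature_xi (u v : Coord m) :
    curvature g y u v (ξ y) = η y u • v - η y v • u := by
  have := h.toIsMetricOn.curvature_eq_of_covDeriv hy (W := fun z v => - φ z v) h.smooth_ξ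
    (fun v => ((h.hasFDerivAt_φ hy).clm_apply (hasFDerivAt_const v y)).neg)
    (fun z hz v => by rw [h.fderiv_xi hz]; simp) u v
  rw [this]
  simp [h.fderiv_phi hy]
  rw [h.symm y hy v u, h.christoffelMap_symm hy v u]
  module

/-- The Ricci identity for the field φw with w constant, whose covariant derivative `hW` is known
from ∇φ. -/
theorem curvature_phi (u v w : Coord m) : curvature g y u v (φ y w)
    = φ y (curvature g y u v w) + g y v w • φ y u - g y u w • φ y v - g y (φ y u) w • v
      + g y (φ y v) w • u := by
  have cw := hasFDerivAt_const (𝕜 := ℝ) w y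
  have hg := h.hasFDerivAt_g hy
  have hφ := h.hasFDerivAt_φ hy
  have hΓ := h.hasFDerivAt_christoffelMap hy
  have hp := h.pointwise y hy
  have hW : ∀ z ∈ U, ∀ v, fderiv ℝ (fun z => φ z w) z v + christoffelMap g z v (φ z w)
      = φ z (christoffelMap g z v w) - g z v w • ξ z + η z w • v := by
    intro z hz v
    rw [((h.hasFDerivAt_φ hz).clm_apply (hasFDerivAt_const w z)).fderiv]
    simp [h.fderiv_phi hz]
    module
  have hW' := fun v => (((h.hasFDerivAt_φ hy).clm_apply
    ((hΓ.clm_apply (hasFDerivAt_const v y)).clm_apply cw)).sub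
    (((hg.clm_apply (hasFDerivAt_const v y)).clm_apply cw).smul (h.hasFDerivAt_ξ hy))).add
    (((h.hasFDerivAt_η hy).clm_apply cw).smul (hasFDerivAt_const v y))
  have := h.toIsMetricOn.curvature_eq_of_covDeriv hy (h.smooth_φ.clm_apply contDiffOn_const)
    hW' hW u v
  rw [this, h.curvature_eq hy]
  simp [h.fderiv_phi hy, h.fderiv_xi hy, h.fderiv_metric hy, h.fderiv_eta_eq hy, hp.g_phi]
  rw [h.symm y hy v (christoffelMap g y u w), h.symm y hy u (christoffelMap g y v w),
    h.christoffelMap_symm hy v u]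
  module

end IsParaSasakianOn

end LocalParaSasakian

/-! ## Ricci curvature and solitons in coordinates -/

section LocalSoliton

variable {m : ℕ}

namespace IsParaSasakianOn

variable {φ : Coord m → Coord m →L[ℝ] Coord m} {ξ : Coord m → Coord m}
  {η : Coord m → Coord m →L[ℝ] ℝ} {g : Coord m → Coord m →L[ℝ] Coord m →L[ℝ] ℝ}
  {U : Set (Coord m)} (h : IsParaSasakianOn φ ξ η g U)

include h

section

variable {y : Coord m} (hy : y ∈ U)

include hy

/-- The trace of u ↦ l(u)v - l(v)u is l(v) - m l(v). It serves twice: for w = ξ with l = η, and for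
w = Df with l = df. -/
theorem ricci_eq_of_curvature {v w : Coord m} {l : Coord m →L[ℝ] ℝ}
    (H : ∀ u, curvature g y u v w = l u • v - l v • u) : ricci g y v w = -((m : ℝ) - 1) * l v := by
  have e : (curvatureEnd g y v w).toLinearMap
      = l.toLinearMap.smulRight v - l v • LinearMap.id := by
    ext1 u
    simp [h.curvatureEnd_apply hy, H]
  rw [h.ricci_eq_trace hy, e, map_sub, map_smul, LinearMap.trace_smulRight, LinearMap.trace_id]
  simp
  ring

theorem ricci_xi (v : Coord m) : ricci g y v (ξ y) = -((m : ℝ) - 1) * η y v :=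
  h.ricci_eq_of_curvature hy fun u => h.curvature_xi hy u v

theorem trace_phi : LinearMap.trace ℝ (Coord m) (φ y).toLinearMap = 0 := by
  have hp := h.pointwise y hy
  have : LinearMap.trace ℝ (Coord m) (φ y).toLinearMap
      = LinearMap.trace ℝ (Coord m) (-(φ y).toLinearMap) :=
    trace_eq_of_adjoint hp.symm hp.nondeg fun u v => by simp [hp.g_phi]
  rw [map_neg] at this
  linarith

/-- By the pair symmetry of R, the g-adjoint of u ↦ φR(u, v)w is x ↦ -R(φx, w)v, and the trace is
cyclic. -/
theorem trace_phi_curvature_skew (v w : Coord m) :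
    LinearMap.trace ℝ (Coord m) ((φ y).toLinearMap ∘ₗ (curvatureEnd g y v w).toLinearMap)
      = - LinearMap.trace ℝ (Coord m)
        ((φ y).toLinearMap ∘ₗ (curvatureEnd g y w v).toLinearMap) := by
  have hp := h.pointwise y hy
  have : LinearMap.trace ℝ (Coord m) ((φ y).toLinearMap ∘ₗ (curvatureEnd g y v w).toLinearMap)
      = LinearMap.trace ℝ (Coord m)
        (-((curvatureEnd g y w v).toLinearMap ∘ₗ (φ y).toLinearMap)) := by
    refine trace_eq_of_adjoint hp.symm hp.nondeg fun u x => ?_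
    have e1 := hp.g_phi (curvature g y u v w) x
    have e2 := h.g_curvature_pair hy u v w (φ y x)
    have e3 := h.g_curvature_skew hy w (φ y x) u v
    have e4 := hp.symm u (curvature g y (φ y x) w v)
    have e5 := curvature_skew g y w (φ y x) v
    simp [h.curvatureEnd_apply hy]
    rw [e4, e5]
    simp
    linarith
  rw [this, map_neg, LinearMap.trace_comp_comm']

/-- Equivalently, the Ricci operator commutes with φ. Tracing `curvature_phi` writes S(v, φw) as a
skew trace plus (m - 2)g(φv, w), which is skew as well. -/
theorem ricci_phi_skew (v w : Coord m) : ricci g y v (φ y w) = - ricci g y w (φ y v) := by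
  have hp := h.pointwise y hy
  have key : ∀ v w, ricci g y v (φ y w)
      = LinearMap.trace ℝ (Coord m) ((φ y).toLinearMap ∘ₗ (curvatureEnd g y v w).toLinearMap)
        + ((m : ℝ) - 2) * g y (φ y v) w := by
    intro v w
    have e : (curvatureEnd g y v (φ y w)).toLinearMap
        = (φ y).toLinearMap ∘ₗ (curvatureEnd g y v w).toLinearMap + g y v w • (φ y).toLinearMap
          - ((g y).flip w).toLinearMap.smulRight (φ y v)
          - (((g y).flip w).comp (φ y)).toLinearMap.smulRight v
          + g y (φ y v) w • LinearMap.id := by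
      ext1 u
      simp [h.curvatureEnd_apply hy, h.curvature_phi hy]
    rw [h.ricci_eq_trace hy, e]
    simp only [map_add, map_sub, map_smul, LinearMap.trace_smulRight, LinearMap.trace_id,
      h.trace_phi hy]
    simp
    ring
  have e1 := hp.g_phi_comm v w
  rw [hp.g_phi, hp.g_phi] at e1
  rw [key, key, h.trace_phi_curvature_skew hy v w]
  linear_combination -((m : ℝ) - 2) * e1

end

/-- A closed one-form which is a multiple of `η` vanishes. -/
theorem fderiv_eq_zero_of_eq_smul_eta (hm : 1 < m) {b : Coord m → ℝ} (hb : ContDiffOn ℝ ∞ b U)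
    (H : ∀ y ∈ U, ∀ v, fderiv ℝ b y v = fderiv ℝ b y (ξ y) * η y v) {y : Coord m} (hy : y ∈ U) :
    fderiv ℝ b y = 0 := by
  have hp := h.pointwise y hy
  have hb2 := (hb.fderiv_infty h.isOpen).hasFDerivAt_of_isOpen h.isOpen hy
  have key := fun u v => hasFDerivAt_apply_eq h.isOpen hy (fun z hz => H z hz v)
    (hb2.clm_apply (hasFDerivAt_const v y))
    ((hb2.clm_apply (h.hasFDerivAt_ξ hy)).mul
      ((h.hasFDerivAt_η hy).clm_apply (hasFDerivAt_const v y))) u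
  obtain ⟨u, v, huv⟩ := hp.exists_g_phi_ne_zero (by simpa using hm)
  -- The arguments φu, φv lie in ker η, so the term with the derivative of ξb drops out of d(db) = 0
  -- and only (ξb) dη(φu, φv) is left.
  have k1 := key (φ y u) (φ y v)
  have k2 := key (φ y v) (φ y u)
  have e := h.d_eta y hy (φ y u) (φ y v)
  simp [hp.eta_phi] at k1 k2
  rw [hp.compat, hp.eta_phi, mul_zero, add_zero] at e
  rw [hb.fderiv_fderiv_comm h.isOpen hy, k2] at k1
  have h0 : fderiv ℝ b y (ξ y) * g y u (φ y v) = 0 := by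
    linear_combination (1 / 2) * k1 + (1 / 2) * fderiv ℝ b y (ξ y) * e
  ext w
  rw [H y hy, (mul_eq_zero.1 h0).resolve_right huv]
  simp

end IsParaSasakianOn

/-- The soliton equation on an open subset of the coordinate space. -/
structure IsSolitonOn (η : Coord m → Coord m →L[ℝ] ℝ)
    (g : Coord m → Coord m →L[ℝ] Coord m →L[ℝ] ℝ) (f a μ : Coord m → ℝ) (U : Set (Coord m)) :
    Prop where
  smooth_f : ContDiffOn ℝ ∞ f U
  smooth_a : ContDiffOn ℝ ∞ a U
  smooth_μ : ContDiffOn ℝ ∞ μ U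
  equation : ∀ y ∈ U, ∀ u v, hessian g f y u v + ricci g y u v + a y * g y u v
    + μ y * (η y u * η y v) = 0

namespace IsSolitonOn

variable {φ : Coord m → Coord m →L[ℝ] Coord m} {ξ : Coord m → Coord m}
  {η : Coord m → Coord m →L[ℝ] ℝ} {g : Coord m → Coord m →L[ℝ] Coord m →L[ℝ] ℝ}
  {U : Set (Coord m)} {f a μ : Coord m → ℝ} (s : IsSolitonOn η g f a μ U)
  (h : IsParaSasakianOn φ ξ η g U)

include s h

theorem fderiv_fderiv_eq {y : Coord m} (hy : y ∈ U) (u v : Coord m) :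
    fderiv ℝ (fderiv ℝ f) y u v = fderiv ℝ f y (christoffelMap g y u v)
      - ricci g y u v - a y * g y u v - μ y * (η y u * η y v) := by
  have := s.equation y hy u v
  rw [h.hessian_eq hy f s.smooth_f] at this
  linarith

/-- Compute the second derivative of k = ξf from the soliton equation and skew it: the left side
vanishes and S(u, φv) appears twice, since it is already skew. -/
theorem ricci_phi_eq {y : Coord m} (hy : y ∈ U) (u v : Coord m) :
    2 * ricci g y u (φ y v) = 2 * (μ y - ((m : ℝ) - 1)) * g y u (φ y v)
      + (fderiv ℝ a y u + fderiv ℝ μ y u + fderiv ℝ f y u) * η y v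
      - (fderiv ℝ a y v + fderiv ℝ μ y v + fderiv ℝ f y v) * η y u := by
  have hf1 := fun {z} (hz : z ∈ U) => (s.smooth_f.fderiv_infty h.isOpen).hasFDerivAt_of_isOpen h.isOpen hz
  have ha := s.smooth_a.hasFDerivAt_of_isOpen h.isOpen hy
  have hμ := s.smooth_μ.hasFDerivAt_of_isOpen h.isOpen hy
  set k : Coord m → ℝ := fun z => fderiv ℝ f z (ξ z) with hk
  have hks : ContDiffOn ℝ ∞ k U := (s.smooth_f.fderiv_infty h.isOpen).clm_apply h.smooth_ξ
  have dk : ∀ z ∈ U, ∀ v, fderiv ℝ k z v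
      = -((a z + μ z - ((m : ℝ) - 1)) * η z v) - fderiv ℝ f z (φ z v) := by
    intro z hz v
    have hp := h.pointwise z hz
    rw [((hf1 hz).clm_apply (h.hasFDerivAt_ξ hz)).fderiv]
    simp [s.fderiv_fderiv_eq h hz, h.fderiv_xi hz, h.ricci_xi hz, hp.g_xi, hp.eta_xi]
    ring
  have hk2 := (hks.fderiv_infty h.isOpen).hasFDerivAt_of_isOpen h.isOpen hy
  have hp := h.pointwise y hy
  have key : ∀ u v, fderiv ℝ (fderiv ℝ k) y u v
      = -((fderiv ℝ a y u + fderiv ℝ μ y u) * η y v)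
        - (a y + μ y - ((m : ℝ) - 1)) * (g y u (φ y v) + η y (christoffelMap g y u v))
        + ricci g y u (φ y v) + a y * g y u (φ y v) - fderiv ℝ f y (φ y (christoffelMap g y u v))
        + g y u v * fderiv ℝ f y (ξ y) - η y v * fderiv ℝ f y u := by
    intro u v
    have cv := hasFDerivAt_const (𝕜 := ℝ) v y
    have := hasFDerivAt_apply_eq h.isOpen hy (fun z hz => dk z hz v) (hk2.clm_apply cv)
      ((((ha.add hμ).sub (hasFDerivAt_const ((m : ℝ) - 1) y)).mul
        ((h.hasFDerivAt_η hy).clm_apply cv)).neg.sub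
        ((hf1 hy).clm_apply ((h.hasFDerivAt_φ hy).clm_apply cv))) u
    simp [s.fderiv_fderiv_eq h hy, h.fderiv_phi hy, h.fderiv_eta_eq hy, hp.eta_phi] at this
    rw [this]
    ring
  have k1 := key u v
  have k2 := key v u
  rw [hks.fderiv_fderiv_comm h.isOpen hy u v] at k1
  rw [h.christoffelMap_symm hy v u, h.ricci_phi_skew hy v u, hp.g_phi_comm v u, h.symm y hy v u] at k2
  linarith

/-- Setting u = ξ in `ricci_phi_eq` kills both S and g, because φξ = 0, and leaves d(a + μ + f)
proportional to η. -/
theorem fderiv_potential (hm : 1 < m) {y : Coord m} (hy : y ∈ U) (u : Coord m) :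
    fderiv ℝ a y u + fderiv ℝ μ y u + fderiv ℝ f y u = 0 := by
  have hb : ContDiffOn ℝ ∞ (a + μ + f) U := (s.smooth_a.add s.smooth_μ).add s.smooth_f
  have e : ∀ z ∈ U, ∀ v, fderiv ℝ (a + μ + f) z v
      = fderiv ℝ a z v + fderiv ℝ μ z v + fderiv ℝ f z v := by
    intro z hz v
    rw [(((s.smooth_a.hasFDerivAt_of_isOpen h.isOpen hz).add
      (s.smooth_μ.hasFDerivAt_of_isOpen h.isOpen hz)).add
      (s.smooth_f.hasFDerivAt_of_isOpen h.isOpen hz)).fderiv]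
    simp
  have := h.fderiv_eq_zero_of_eq_smul_eta hm hb (fun z hz v => by
    have hp := h.pointwise z hz
    have := s.ricci_phi_eq h hz (ξ z) v
    rw [h.ricci_phi_skew hz, hp.phi_xi, hp.g_phi, hp.phi_xi, hp.eta_xi] at this
    have r0 : ricci g z v 0 = 0 := by
      rw [h.ricci_eq_trace hz]
      have : curvatureEnd g z v 0 = 0 := by ext1; simp [curvatureEnd]
      simp [this]
    simp [r0] at this
    rw [e z hz, e z hz]
    linarith) hy
  rw [← e y hy, this]
  simp

/-- Replacing v by φv in `ricci_phi_eq` determines S(u, φ²v); the missing ξ-component is `ricci_xi`.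
-/
theorem ricci_eq (hm : 1 < m) {y : Coord m} (hy : y ∈ U) (u v : Coord m) :
    ricci g y u v = (μ y - ((m : ℝ) - 1)) * g y u v - μ y * (η y u * η y v) := by
  have hp := h.pointwise y hy
  have h1 := s.ricci_phi_eq h hy u (φ y v)
  rw [s.fderiv_potential h hm hy, s.fderiv_potential h hm hy, hp.g_phi_phi, hp.phi_sq] at h1
  have h2 : ricci g y u (v - η y v • ξ y) = ricci g y u v - η y v * ricci g y u (ξ y) := by
    simp only [h.ricci_eq_trace hy]
    have : curvatureEnd g y u (v - η y v • ξ y)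
      = curvatureEnd g y u v - η y v • curvatureEnd g y u (ξ y) := by
      ext1 x
      simp [curvatureEnd]
      module
    rw [this]
    simp
  rw [h2, h.ricci_xi hy] at h1
  linarith

theorem hessian_eq (hm : 1 < m) {y : Coord m} (hy : y ∈ U) (u v : Coord m) :
    hessian g f y u v = -(a y + μ y - ((m : ℝ) - 1)) * g y u v := by
  have h1 := s.equation y hy u v
  rw [s.ricci_eq h hm hy] at h1
  linarith

theorem fderiv_fderiv_eq' (hm : 1 < m) {y : Coord m} (hy : y ∈ U) (u v : Coord m) :
    fderiv ℝ (fderiv ℝ f) y u v = fderiv ℝ f y (christoffelMap g y u v)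
      - (a y + μ y - ((m : ℝ) - 1)) * g y u v := by
  have h1 := s.hessian_eq h hm hy u v
  rw [h.hessian_eq hy f s.smooth_f] at h1
  linarith

/-- The gradient Df, here `V`, satisfies ∇_v V = -c v with dc = -df, so its curvature is explicit.
The resulting S(v, V) is compared with the one from `ricci_eq`. -/
theorem mu_mul_fderiv (hm : 1 < m) {y : Coord m} (hy : y ∈ U) (v : Coord m) :
    μ y * (fderiv ℝ f y v - fderiv ℝ f y (ξ y) * η y v) = 0 := by
  have hp := h.pointwise y hy
  have hf1 := s.smooth_f.fderiv_infty h.isOpen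
  set V : Coord m → Coord m := fun z => (g z).inverse (fderiv ℝ f z) with hV
  have gV : ∀ z ∈ U, ∀ w, g z (V z) w = fderiv ℝ f z w := fun z hz w => by
    rw [hV, h.apply_inverse hz]
  have hVs : ContDiffOn ℝ ∞ V U := by
    refine ContDiffOn.clm_apply (fun z hz => ?_) hf1
    exact ((h.isInvertible hz).contDiffAt_map_inverse.comp z
      (h.smooth.contDiffAt (h.isOpen.mem_nhds hz))).contDiffWithinAt
  have nabla : ∀ z ∈ U, ∀ v, fderiv ℝ V z v + christoffelMap g z v (V z)
      = -(a z + μ z - ((m : ℝ) - 1)) • v := by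
    intro z hz v
    refine h.eq_of_forall hz fun w => ?_
    have cw := hasFDerivAt_const (𝕜 := ℝ) w z
    have := hasFDerivAt_apply_eq h.isOpen hz (fun x hx => gV x hx w)
      (((h.hasFDerivAt_g hz).clm_apply (hVs.hasFDerivAt_of_isOpen h.isOpen hz)).clm_apply cw)
      ((hf1.hasFDerivAt_of_isOpen h.isOpen hz).clm_apply cw) v
    simp [h.fderiv_metric hz, s.fderiv_fderiv_eq' h hm hz, gV z hz] at this
    simp
    linarith
  have hc := fun v : Coord m => ((((s.smooth_a.hasFDerivAt_of_isOpen h.isOpen hy).add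
    (s.smooth_μ.hasFDerivAt_of_isOpen h.isOpen hy)).sub
    (hasFDerivAt_const ((m : ℝ) - 1) y)).neg).smul (hasFDerivAt_const v y)
  have hR : ∀ u, curvature g y u v (V y) = fderiv ℝ f y u • v - fderiv ℝ f y v • u := by
    intro u
    rw [h.toIsMetricOn.curvature_eq_of_covDeriv hy hVs hc nabla u v]
    have e1 : fderiv ℝ f y u = -(fderiv ℝ a y u + fderiv ℝ μ y u) := by
      linarith [s.fderiv_potential h hm hy u]
    have e2 : fderiv ℝ f y v = -(fderiv ℝ a y v + fderiv ℝ μ y v) := by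
      linarith [s.fderiv_potential h hm hy v]
    rw [e1, e2]
    simp [h.christoffelMap_symm hy v u]
    module
  have h1 := h.ricci_eq_of_curvature hy hR
  rw [s.ricci_eq h hm hy, ← hp.g_xi (V y), gV y hy, hp.symm v, gV y hy] at h1
  linarith

theorem fderiv_eq_zero_of_mu_ne_zero (hm : 1 < m) {y : Coord m} (hy : y ∈ U) (hμ : μ y ≠ 0) :
    fderiv ℝ f y = 0 ∧ a y + μ y - ((m : ℝ) - 1) = 0 := by
  set V := U ∩ μ ⁻¹' {0}ᶜ with hV
  have hVo : IsOpen V := s.smooth_μ.continuousOn.isOpen_inter_preimage h.isOpen isOpen_compl_singleton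
  have hVU : V ⊆ U := Set.inter_subset_left
  have hyV : y ∈ V := ⟨hy, hμ⟩
  have h0 : ∀ z ∈ V, fderiv ℝ f z = 0 := fun z hz =>
    (h.mono hVo hVU).fderiv_eq_zero_of_eq_smul_eta hm (s.smooth_f.mono hVU) (fun x hx v => by
      have := s.mu_mul_fderiv h hm (hVU hx) v
      rcases mul_eq_zero.1 this with h1 | h1
      · exact absurd h1 hx.2
      · linarith) hz
  refine ⟨h0 y hyV, ?_⟩
  have hp := h.pointwise y hy
  obtain ⟨u, v, huv⟩ := hp.exists_g_phi_ne_zero (by simpa using hm)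
  have h2 : fderiv ℝ (fderiv ℝ f) y = 0 := by
    have : fderiv ℝ f =ᶠ[𝓝 y] fun _ => 0 := by
      filter_upwards [hVo.mem_nhds hyV] with z hz using h0 z hz
    rw [this.fderiv_eq]; simp
  have h3 := s.fderiv_fderiv_eq' h hm hy u (φ y v)
  rw [h2, h0 y hyV] at h3
  simp at h3
  tauto

/-- Unique continuation for the overdetermined system satisfied by the potential function. -/
theorem eventually_fderiv_eq_zero (hm : 1 < m) {y : Coord m} (hy : y ∈ U)
    (hf : fderiv ℝ f y = 0) (hc : a y + μ y - ((m : ℝ) - 1) = 0) :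
    ∀ᶠ z in 𝓝 y, fderiv ℝ f z = 0 ∧ a z + μ z - ((m : ℝ) - 1) = 0 := by
  set H : Coord m → (Coord m →L[ℝ] ℝ) × ℝ :=
    fun z => (fderiv ℝ f z, a z + μ z - ((m : ℝ) - 1)) with hH
  -- The derivative of (df, c) is linear in (df, c) itself, so it is bounded by the norm of that
  -- pair, with a factor continuous in the point.
  have hHd : ∀ z ∈ U, ∃ L : Coord m →L[ℝ] (Coord m →L[ℝ] ℝ) × ℝ, HasFDerivAt H L z ∧
      ∀ u, ‖L u‖ ≤ (‖christoffelMap g z‖ + ‖g z‖ + 1) * ‖u‖ * ‖H z‖ := by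
    intro z hz
    refine ⟨_, ((s.smooth_f.fderiv_infty h.isOpen).hasFDerivAt_of_isOpen h.isOpen hz).prodMk
      (((s.smooth_a.hasFDerivAt_of_isOpen h.isOpen hz).add
    (s.smooth_μ.hasFDerivAt_of_isOpen h.isOpen hz)).sub
    (hasFDerivAt_const ((m : ℝ) - 1) z)), fun u => ?_⟩
    have n1 : ‖fderiv ℝ f z‖ ≤ ‖H z‖ := norm_fst_le (H z)
    have n2 : ‖a z + μ z - ((m : ℝ) - 1)‖ ≤ ‖H z‖ := norm_snd_le (H z)
    refine max_le ?_ ?_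
    · have e : fderiv ℝ (fderiv ℝ f) z u = (fderiv ℝ f z).comp (christoffelMap g z u)
          - (a z + μ z - ((m : ℝ) - 1)) • g z u := by
        ext1 w
        simp [s.fderiv_fderiv_eq' h hm hz]
      calc ‖fderiv ℝ (fderiv ℝ f) z u‖
          ≤ ‖(fderiv ℝ f z).comp (christoffelMap g z u)‖
            + ‖(a z + μ z - ((m : ℝ) - 1)) • g z u‖ := by rw [e]; exact norm_sub_le _ _
        _ ≤ ‖H z‖ * (‖christoffelMap g z‖ * ‖u‖) + ‖H z‖ * (‖g z‖ * ‖u‖) := by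
          refine add_le_add ((ContinuousLinearMap.opNorm_comp_le _ _).trans ?_) ?_
          · gcongr; exact ContinuousLinearMap.le_opNorm _ _
          · rw [norm_smul]; gcongr; exact ContinuousLinearMap.le_opNorm _ _
        _ ≤ _ := by nlinarith [mul_nonneg (norm_nonneg u) (norm_nonneg (H z))]
    · have e : fderiv ℝ a z u + fderiv ℝ μ z u = - fderiv ℝ f z u := by
        linarith [s.fderiv_potential h hm hz u]
      calc ‖fderiv ℝ a z u + fderiv ℝ μ z u - 0‖ ≤ ‖H z‖ * ‖u‖ := by
            rw [e, sub_zero, norm_neg]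
            refine (ContinuousLinearMap.le_opNorm _ _).trans ?_
            gcongr
        _ ≤ _ := by
          have := mul_nonneg (norm_nonneg u) (norm_nonneg (H z))
          nlinarith [mul_nonneg (norm_nonneg (christoffelMap g z)) this,
            mul_nonneg (norm_nonneg (g z)) this]
  set K := ‖christoffelMap g y‖ + ‖g y‖ + 1 + 1 with hK
  have hcont : ContinuousAt (fun z => ‖christoffelMap g z‖ + ‖g z‖ + 1) y :=
    (((h.hasFDerivAt_christoffelMap hy).continuousAt.norm).add
      ((h.hasFDerivAt_g hy).continuousAt.norm)).add continuousAt_const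
  have hev : ∀ᶠ z in 𝓝 y, z ∈ U ∧ ‖christoffelMap g z‖ + ‖g z‖ + 1 < K :=
    Filter.Eventually.and (h.isOpen.mem_nhds hy) (hcont.eventually_lt continuousAt_const (lt_add_one _))
  obtain ⟨r, hr, hball⟩ := Metric.eventually_nhds_iff_ball.1 hev
  filter_upwards [Metric.ball_mem_nhds y hr] with z hz
  have hseg : ∀ t ∈ Set.Icc (0 : ℝ) 1, y + t • (z - y) ∈ Metric.ball y r := fun t ht =>
    (convex_ball y r).add_smul_sub_mem (Metric.mem_ball_self hr) hz ht
  choose! L hL hLb using hHd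
  have hder : ∀ t ∈ Set.Icc (0 : ℝ) 1, HasDerivAt (fun t : ℝ => H (y + t • (z - y)))
      (L (y + t • (z - y)) (z - y)) t := by
    intro t ht
    have h1 : HasDerivAt (fun t : ℝ => y + t • (z - y)) (z - y) t := by
      simpa using ((hasDerivAt_id t).smul_const (z - y)).const_add y
    exact (hL _ (hball _ (hseg t ht)).1).comp_hasDerivAt t h1
  -- Grönwall's inequality along the segment from y to z, where (df, c) starts at zero; the extra 1
  -- in `K` gives a uniform bound on a small ball.
  have := eq_zero_of_abs_deriv_le_mul_abs_self_of_eq_zero_right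
    (f := fun t : ℝ => H (y + t • (z - y))) (f' := fun t => L (y + t • (z - y)) (z - y))
    (K := K * ‖z - y‖) (a := 0) (b := 1)
    (fun t ht => (hder t ht).continuousAt.continuousWithinAt)
    (fun t ht => (hder t (Set.Ico_subset_Icc_self ht)).hasDerivWithinAt)
    (by simp [hH, hf, hc]) (fun t ht => by
      have hb := hball _ (hseg t (Set.Ico_subset_Icc_self ht))
      refine (hLb _ hb.1 _).trans ?_
      have := hb.2
      gcongr) 1 (by simp)
  simpa [hH] using this

end IsSolitonOn

end LocalSoliton

/-! ## Passing from the manifold to a chart -/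

section ChartTransfer

variable {m : ℕ} {M : Type*} [TopologicalSpace M] [ChartedSpace (Coord m) M]
  [IsManifold (𝓡 m) ∞ M]

omit [IsManifold (𝓡 m) ∞ M] in
theorem isOpen_chartDomain (c : M) : IsOpen (chartDomain (m := m) c) :=
  isOpen_extChartAt_target c

omit [IsManifold (𝓡 m) ∞ M] in
theorem chartPoint_mem {c : M} {y : Coord m} (hy : y ∈ chartDomain c) :
    chartPoint c y ∈ (chartAt (Coord m) c).source := by
  have := (extChartAt (𝓡 m) c).map_target hy
  rwa [extChartAt_source] at this

theorem toCoord_fromCoord {c : M} {y : Coord m} (hy : y ∈ chartDomain c) (u : Coord m) :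
    toCoord c y (fromCoord c y u) = u := by
  have := mfderiv_extChartAt_comp_mfderivWithin_extChartAt_symm (I := 𝓡 m) hy
  rw [ModelWithCorners.range_eq_univ, mfderivWithin_univ] at this
  exact DFunLike.congr_fun this u

theorem fromCoord_toCoord {c : M} {y : Coord m} (hy : y ∈ chartDomain c)
    (u : TangentSpace (𝓡 m) (chartPoint c y)) : fromCoord c y (toCoord c y u) = u := by
  have := mfderivWithin_extChartAt_symm_comp_mfderiv_extChartAt (I := 𝓡 m) hy
  rw [ModelWithCorners.range_eq_univ, mfderivWithin_univ] at this
  exact DFunLike.congr_fun this u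

/-- Components in the chart agree with the tangent bundle trivialization, so smoothness of sections
passes to smoothness of components. -/
theorem toCoord_eq {c : M} {y : Coord m} (hy : y ∈ chartDomain c)
    (v : TangentSpace (𝓡 m) (chartPoint c y)) :
    toCoord c y v = ((trivializationAt (Coord m) (TangentSpace (𝓡 m)) c) ⟨chartPoint c y, v⟩).2 := by
  have h := TangentBundle.continuousLinearMapAt_trivializationAt (I := 𝓡 m) (chartPoint_mem hy)
  have h2 : toCoord c y v = (trivializationAt (Coord m) (TangentSpace (𝓡 m)) c).continuousLinearMapAt
      ℝ (chartPoint c y) v := by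
    rw [h]; rfl
  rw [h2]
  exact Bundle.Trivialization.continuousLinearMapAt_apply_of_mem ℝ _
    (by simpa using chartPoint_mem hy) v

theorem fromCoord_eq {c : M} {y : Coord m} (hy : y ∈ chartDomain c) (u : Coord m) :
    fromCoord c y u
      = (trivializationAt (Coord m) (TangentSpace (𝓡 m)) c).symmL ℝ (chartPoint c y) u := by
  set e := trivializationAt (Coord m) (TangentSpace (𝓡 m) : M → Type _) c
  have hx : chartPoint c y ∈ e.baseSet := by simpa [e] using chartPoint_mem hy
  rw [← e.symmL_continuousLinearMapAt (R := ℝ) hx (fromCoord c y u),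
    e.continuousLinearMapAt_apply_of_mem ℝ hx, ← toCoord_eq hy, toCoord_fromCoord hy]

/-- The coordinate vector field with constant components `u`. -/
def coordField (c : M) (u : Coord m) (x : M) : TangentSpace (𝓡 m) x :=
  (trivializationAt (Coord m) (TangentSpace (𝓡 m)) c).symmL ℝ x u

theorem contMDiffOn_coordField (c : M) (u : Coord m) :
    ContMDiffOn (𝓡 m) (𝓡 m).tangent ∞
      (fun x => (⟨x, coordField c u x⟩ : TangentBundle (𝓡 m) M)) (chartAt (Coord m) c).source := by
  have := ((trivializationAt (Coord m) (TangentSpace (𝓡 m) : M → Type _) c).contMDiffOn_section_baseSet_iff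
    (IB := 𝓡 m) (n := ∞) (s := coordField c u)).2 (by
      apply (contMDiffOn_const (c := u)).congr
      intro y hy
      rw [coordField, Bundle.Trivialization.symmL_apply _ hy,
        Bundle.Trivialization.apply_mk_symm _ hy])
  simpa using this

theorem contDiffOn_of_contMDiffOn {F : Type*} [NormedAddCommGroup F] [NormedSpace ℝ F] (c : M)
    {f : M → F} (hf : ContMDiffOn (𝓡 m) 𝓘(ℝ, F) ∞ f (chartAt (Coord m) c).source) :
    ContDiffOn ℝ ∞ (fun y => f (chartPoint c y)) (chartDomain (m := m) c) := by
  rw [← contMDiffOn_iff_contDiffOn]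
  exact hf.comp (contMDiffOn_extChartAt_symm c) fun y hy => chartPoint_mem hy

theorem contDiffOn_readFun (c : M) {f : M → ℝ} (hf : ContMDiff (𝓡 m) 𝓘(ℝ, ℝ) ∞ f) :
    ContDiffOn ℝ ∞ (readFun (m := m) c f) (chartDomain c) :=
  contDiffOn_of_contMDiffOn c hf.contMDiffOn

theorem contDiffOn_toCoord (c : M) {s : ∀ x : M, TangentSpace (𝓡 m) x}
    (hs : ContMDiffOn (𝓡 m) (𝓡 m).tangent ∞ (fun x => (⟨x, s x⟩ : TangentBundle (𝓡 m) M))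
      (chartAt (Coord m) c).source) :
    ContDiffOn ℝ ∞ (fun y => toCoord c y (s (chartPoint c y))) (chartDomain c) := by
  have := ((trivializationAt (Coord m) (TangentSpace (𝓡 m) : M → Type _) c).contMDiffOn_section_baseSet_iff
    (IB := 𝓡 m) (n := ∞) (s := s)).1 (by simpa using hs)
  refine (contDiffOn_of_contMDiffOn c (by simpa using this)).congr fun y hy => ?_
  exact toCoord_eq hy _

theorem contDiffOn_readVec (c : M) {ξ : ∀ x : M, TangentSpace (𝓡 m) x}
    (hξ : ContMDiff (𝓡 m) (𝓡 m).tangent ∞ (fun x => (⟨x, ξ x⟩ : TangentBundle (𝓡 m) M))) :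
    ContDiffOn ℝ ∞ (readVec c ξ) (chartDomain c) :=
  contDiffOn_toCoord c hξ.contMDiffOn

theorem contDiffOn_readForm (c : M) {η : ∀ x : M, TangentSpace (𝓡 m) x →L[ℝ] ℝ}
    (hη : ContMDiff (𝓡 m) ((𝓡 m).prod 𝓘(ℝ, Coord m →L[ℝ] ℝ)) ∞
      (fun x => Bundle.TotalSpace.mk' (Coord m →L[ℝ] ℝ)
        (E := fun x : M => TangentSpace (𝓡 m) x →L[ℝ] ℝ) x (η x))) :
    ContDiffOn ℝ ∞ (readForm c η) (chartDomain c) := by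
  rw [contDiffOn_clm_apply]
  intro u
  have h1 : ContMDiffOn (𝓡 m) ((𝓡 m).prod 𝓘(ℝ)) ∞
      (fun x => Bundle.TotalSpace.mk' ℝ (E := Bundle.Trivial M ℝ) x (η x (coordField c u x)))
      (chartAt (Coord m) c).source :=
    ContMDiffOn.clm_bundle_apply (F₁ := Coord m) hη.contMDiffOn (contMDiffOn_coordField c u)
  have h2 : ContMDiffOn (𝓡 m) 𝓘(ℝ) ∞ (fun x => η x (coordField c u x))
      (chartAt (Coord m) c).source := fun x hx => by
    have := h1 x hx
    simp only [Bundle.contMDiffWithinAt_totalSpace] at this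
    exact this.2
  refine (contDiffOn_of_contMDiffOn c h2).congr fun y hy => ?_
  simp [readForm, fromCoord_eq hy, coordField]

theorem contDiffOn_readEnd (c : M)
    {φ : ∀ x : M, TangentSpace (𝓡 m) x →L[ℝ] TangentSpace (𝓡 m) x}
    (hφ : ContMDiff (𝓡 m) ((𝓡 m).prod 𝓘(ℝ, Coord m →L[ℝ] Coord m)) ∞
      (fun x => Bundle.TotalSpace.mk' (Coord m →L[ℝ] Coord m)
        (E := fun x : M => TangentSpace (𝓡 m) x →L[ℝ] TangentSpace (𝓡 m) x) x (φ x))) :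
    ContDiffOn ℝ ∞ (readEnd c φ) (chartDomain c) := by
  rw [contDiffOn_clm_apply]
  intro u
  have h1 : ContMDiffOn (𝓡 m) (𝓡 m).tangent ∞
      (fun x => (⟨x, φ x (coordField c u x)⟩ : TangentBundle (𝓡 m) M))
      (chartAt (Coord m) c).source :=
    ContMDiffOn.clm_bundle_apply (F₁ := Coord m) (F₂ := Coord m) hφ.contMDiffOn
      (contMDiffOn_coordField c u)
  refine (contDiffOn_toCoord c h1).congr fun y hy => ?_
  simp [readEnd, fromCoord_eq hy, coordField]

theorem contDiffOn_readBilin (c : M)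
    {g : ∀ x : M, TangentSpace (𝓡 m) x →L[ℝ] TangentSpace (𝓡 m) x →L[ℝ] ℝ}
    (hg : ContMDiff (𝓡 m) ((𝓡 m).prod 𝓘(ℝ, Coord m →L[ℝ] Coord m →L[ℝ] ℝ)) ∞
      (fun x => Bundle.TotalSpace.mk' (Coord m →L[ℝ] Coord m →L[ℝ] ℝ)
        (E := fun x : M => TangentSpace (𝓡 m) x →L[ℝ] TangentSpace (𝓡 m) x →L[ℝ] ℝ) x (g x))) :
    ContDiffOn ℝ ∞ (readBilin c g) (chartDomain c) := by
  rw [contDiffOn_clm_apply]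
  intro u
  rw [contDiffOn_clm_apply]
  intro v
  have h1 : ContMDiffOn (𝓡 m) ((𝓡 m).prod 𝓘(ℝ)) ∞
      (fun x => Bundle.TotalSpace.mk' ℝ (E := Bundle.Trivial M ℝ) x
        (g x (coordField c u x) (coordField c v x)))
      (chartAt (Coord m) c).source :=
    ContMDiffOn.clm_bundle_apply₂ (F₁ := Coord m) (F₂ := Coord m) hg.contMDiffOn
      (contMDiffOn_coordField c u) (contMDiffOn_coordField c v)
  have h2 : ContMDiffOn (𝓡 m) 𝓘(ℝ) ∞ (fun x => g x (coordField c u x) (coordField c v x))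
      (chartAt (Coord m) c).source := fun x hx => by
    have := h1 x hx
    simp only [Bundle.contMDiffWithinAt_totalSpace] at this
    exact this.2
  refine (contDiffOn_of_contMDiffOn c h2).congr fun y hy => ?_
  simp [readBilin, fromCoord_eq hy, coordField]

/-- The chart has invertible derivative, so vanishing of df is independent of the chart in which it
is tested. -/
theorem fderiv_readFun_eq_zero_iff (c : M) {f : M → ℝ} (hf : ContMDiff (𝓡 m) 𝓘(ℝ, ℝ) ∞ f)
    {y : Coord m} (hy : y ∈ chartDomain c) :
    fderiv ℝ (readFun c f) y = 0 ↔ mfderiv (𝓡 m) 𝓘(ℝ, ℝ) f (chartPoint c y) = 0 := by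
  have h1 : MDifferentiableAt (𝓡 m) 𝓘(ℝ, ℝ) f (chartPoint c y) :=
    (hf (chartPoint c y)).mdifferentiableAt (by simp)
  have h2 : MDifferentiableAt 𝓘(ℝ, Coord m) (𝓡 m) (extChartAt (𝓡 m) c).symm y :=
    ((contMDiffOn_extChartAt_symm (n := ∞) c).contMDiffAt
      ((isOpen_chartDomain c).mem_nhds hy)).mdifferentiableAt (by simp)
  have h3 : ∀ u, fderiv ℝ (readFun c f) y u
      = mfderiv (𝓡 m) 𝓘(ℝ, ℝ) f (chartPoint c y) (fromCoord c y u) := by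
    intro u
    have := mfderiv_comp y h1 h2
    rw [← mfderiv_eq_fderiv]
    exact DFunLike.congr_fun this u
  constructor
  · intro h
    ext u
    rw [← fromCoord_toCoord hy u]
    exact (h3 _).symm.trans (by rw [h]; rfl)
  · intro h
    ext u
    rw [h3, h]
    rfl

end ChartTransfer

/-! ### The connectedness argument on the manifold and the Einstein condition -/

section Main

variable {n : ℕ} {M : Type*} [TopologicalSpace M] [ChartedSpace (Coord (2 * n + 1)) M]
  [IsManifold (𝓡 (2 * n + 1)) ∞ M]

theorem IsParaSasakian.isParaSasakianOn {A : AlmostParacontactMetric n M} (hA : IsParaSasakian A)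
    (c : M) : IsParaSasakianOn (readEnd c A.φ) (readVec c A.ξ) (readForm c A.η) (readBilin c A.g)
      (chartDomain c) := by
  have hφ := contDiffOn_readEnd c A.smooth_φ
  have hη := contDiffOn_readForm c A.smooth_η
  have hU := isOpen_chartDomain (m := 2 * n + 1) c
  have ed : ∀ y ∈ chartDomain c, ∀ u v : Coord (2 * n + 1),
      extDeriv1 (readForm c A.η) (fun _ => u) (fun _ => v) y
        = (1 / 2) * (fderiv ℝ (readForm c A.η) y u v - fderiv ℝ (readForm c A.η) y v u) := by
    intro y hy u v
    have hd := hη.hasFDerivAt_of_isOpen hU hy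
    rw [extDeriv1, (hd.clm_apply (hasFDerivAt_const u y)).fderiv,
      (hd.clm_apply (hasFDerivAt_const v y)).fderiv]
    simp [VectorField.lieBracket]
  have nd : ∀ y ∈ chartDomain c, ∀ u,
      (∀ v, readBilin c A.g y u v = 0) → u = 0 := by
    intro y hy u hu
    have : fromCoord c y u = 0 := A.g_nondegenerate _ _ fun v => by
      rw [← fromCoord_toCoord hy v]
      exact hu _
    rw [← toCoord_fromCoord hy u, this, map_zero]
  have sy : ∀ y ∈ chartDomain c, ∀ u v, readBilin c A.g y u v = readBilin c A.g y v u :=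
    fun y hy u v => A.g_symm _ _ _
  exact
  { isOpen := hU
    smooth := contDiffOn_readBilin c A.smooth_g
    symm := sy
    nondeg := nd
    smooth_φ := hφ
    smooth_ξ := contDiffOn_readVec c A.smooth_ξ
    smooth_η := hη
    pointwise := fun y hy =>
    { phi_sq := fun u => by
        simp [readEnd, readForm, readVec, fromCoord_toCoord hy, A.phi_sq, toCoord_fromCoord hy]
      eta_xi := by simp [readForm, readVec, fromCoord_toCoord hy, A.eta_xi]
      symm := sy y hy
      nondeg := nd y hy
      compat := fun u v => by
        simp [readEnd, readForm, readBilin, fromCoord_toCoord hy, A.g_compat] }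
    d_eta := fun y hy u v => by
      have := hA.paracontact c y hy (fun _ => u) (fun _ => v) contDiff_const contDiff_const
      rw [ed y hy] at this
      linarith
    -- For constant fields [u, v] = 0, so the Nijenhuis tensor reduces to first derivatives of φ.
    normal := fun y hy u v => by
      have h1 := hA.normal c y hy (fun _ => u) (fun _ => v) contDiff_const contDiff_const
      have h2 := hA.paracontact c y hy (fun _ => u) (fun _ => v) contDiff_const contDiff_const
      have hd := hφ.hasFDerivAt_of_isOpen hU hy
      have e : ∀ w, fderiv ℝ (fun z => readEnd c A.φ z w) y
          = (fderiv ℝ (readEnd c A.φ) y).flip w := fun w => by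
        rw [(hd.clm_apply (hasFDerivAt_const w y)).fderiv]; ext; simp
      rw [h2] at h1
      simp only [nijenhuis, VectorField.lieBracket, e] at h1
      simp at h1
      rw [← sub_eq_zero, ← h1] }

theorem IsGradientAlmostConformalEtaRicciSoliton.isSolitonOn {A : AlmostParacontactMetric n M}
    {f lam mu p : M → ℝ} (hs : IsGradientAlmostConformalEtaRicciSoliton A f lam mu p) (c : M) :
    IsSolitonOn (readForm c A.η) (readBilin c A.g) (readFun c f)
      (readFun c fun x => lam x - (p x / 2 + 1 / (2 * (n : ℝ) + 1))) (readFun c mu)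
      (chartDomain c) where
  smooth_f := contDiffOn_readFun c hs.smooth_f
  smooth_a := (contDiffOn_readFun c hs.smooth_lam).sub
    (((contDiffOn_readFun c hs.smooth_p).div_const 2).add contDiffOn_const)
  smooth_μ := contDiffOn_readFun c hs.smooth_mu
  equation := hs.equation c

theorem IsGradientAlmostConformalEtaRicciSoliton.mu_eq_zero [PreconnectedSpace M] (hn : 0 < n)
    {A : AlmostParacontactMetric n M} (hA : IsParaSasakian A) {f lam mu p : M → ℝ}
    (hs : IsGradientAlmostConformalEtaRicciSoliton A f lam mu p) (x : M) : mu x = 0 := by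
  have hm : 1 < 2 * n + 1 := by omega
  set a : M → ℝ := fun x => lam x - (p x / 2 + 1 / (2 * (n : ℝ) + 1)) with ha
  set k : ℝ := ((2 * n + 1 : ℕ) : ℝ) - 1 with hk
  set P : M → Prop := fun x => mfderiv (𝓡 (2 * n + 1)) 𝓘(ℝ, ℝ) f x = 0 ∧ a x + mu x - k = 0 with hP
  let Q : M → Coord (2 * n + 1) → Prop := fun c z =>
    fderiv ℝ (readFun c f) z = 0 ∧ readFun c a z + readFun c mu z - k = 0
  have hPQ : ∀ c : M, ∀ z ∈ chartDomain c, (Q c z ↔ P (chartPoint c z)) := fun c z hz =>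
    and_congr (fderiv_readFun_eq_zero_iff c hs.smooth_f hz) Iff.rfl
  have hchart : ∀ c : M, extChartAt (𝓡 (2 * n + 1)) c c ∈ chartDomain (m := 2 * n + 1) c :=
    fun c => mem_extChartAt_target c
  have hpt : ∀ c : M, chartPoint (m := 2 * n + 1) c (extChartAt (𝓡 (2 * n + 1)) c c) = c :=
    fun c => extChartAt_to_inv c
  have hQ : ∀ c : M, ∀ᶠ z in 𝓝 (extChartAt (𝓡 (2 * n + 1)) c c),
      (Q c z ↔ Q c (extChartAt (𝓡 (2 * n + 1)) c c)) := by
    intro c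
    have s := hs.isSolitonOn c
    have h := hA.isParaSasakianOn c
    by_cases hq : Q c (extChartAt (𝓡 (2 * n + 1)) c c)
    · filter_upwards [s.eventually_fderiv_eq_zero h hm (hchart c) hq.1 hq.2] with z hz
      exact iff_of_true hz hq
    · have c1 := ((s.smooth_f.fderiv_infty h.isOpen).continuousOn.continuousAt
        (h.isOpen.mem_nhds (hchart c)))
      have c2 := (((s.smooth_a.add s.smooth_μ).sub (contDiffOn_const (c := k))).continuousOn.continuousAt
        (h.isOpen.mem_nhds (hchart c)))
      rcases not_and_or.1 hq with h1 | h1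
      · filter_upwards [c1.eventually_ne h1] with z hz
        exact iff_of_false (fun t => hz t.1) hq
      · filter_upwards [c2.eventually_ne h1] with z hz
        exact iff_of_false (fun t => hz t.2) hq
  -- The set where df = 0 and c = 0 is open by unique continuation and its complement is open by
  -- continuity.
  have hloc : IsLocallyConstant P := by
    rw [IsLocallyConstant.iff_eventually_eq]
    intro c
    have hc : ContinuousAt (extChartAt (𝓡 (2 * n + 1)) c) c := continuousAt_extChartAt c
    filter_upwards [hc.eventually (hQ c), extChartAt_source_mem_nhds (I := 𝓡 (2 * n + 1)) c] with x h1 hx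
    have e1 := hPQ c _ ((extChartAt (𝓡 (2 * n + 1)) c).map_source hx)
    have e2 := hPQ c _ (hchart c)
    rw [hpt] at e2
    have e3 : chartPoint (m := 2 * n + 1) c (extChartAt (𝓡 (2 * n + 1)) c x) = x :=
      (extChartAt (𝓡 (2 * n + 1)) c).left_inv hx
    rw [e3] at e1
    exact propext (e1.symm.trans (h1.trans e2))
  by_contra hx
  have hPx : P x := by
    have := (hs.isSolitonOn x).fderiv_eq_zero_of_mu_ne_zero (hA.isParaSasakianOn x) hm (hchart x)
      (by rwa [readFun, hpt])
    rw [← hpt x]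
    exact (hPQ x _ (hchart x)).1 this
  obtain ⟨x', hx'⟩ := hs.nonzero
  have : P x' := by rw [hloc.apply_eq_of_preconnectedSpace x' x]; exact hPx
  exact hx' this.1

/-- Expand g(u, ·) in the coordinate forms dx^j and apply the inverse metric. -/
theorem ricciOp_eq_of_ricci {m : ℕ} {g : Coord m → Coord m →L[ℝ] Coord m →L[ℝ] ℝ}
    {U : Set (Coord m)} (hg : IsMetricOn g U) {y : Coord m} (hy : y ∈ U) {k : ℝ}
    (H : ∀ u v, ricci g y u v = k * g y u v) (u : Coord m) : ricciOp g y u = k • u := by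
  have e : g y u = ∑ j, g y u (coordVec j) • (EuclideanSpace.proj j : Coord m →L[ℝ] ℝ) := by
    ext w
    conv_lhs => rw [← (EuclideanSpace.basisFun (Fin m) ℝ).sum_repr w]
    simp [coordVec, mul_comm]
  obtain ⟨G, hG⟩ := hg.isInvertible hy
  have e2 := hg.inverse_apply hy u
  rw [e, ← hG, map_sum] at e2
  rw [ricciOp]
  simp only [H, mul_smul]
  rw [← Finset.smul_sum]
  congr 1
  conv_rhs => rw [← e2]
  simp [← hG]

theorem scalarCurvature_eq_of_ricciOp {m : ℕ} {g : Coord m → Coord m →L[ℝ] Coord m →L[ℝ] ℝ}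
    {y : Coord m} {k : ℝ} (H : ∀ u, ricciOp g y u = k • u) : scalarCurvature g y = k * m := by
  simp [scalarCurvature, H, coordVec, mul_comm]

end Main

end ParaSasaki
end

theorem theorem4p3 (n : ℕ) (hn : 3 < 2 * n + 1)
    (M : Type*) [TopologicalSpace M] [T2Space M] [SecondCountableTopology M] [ConnectedSpace M]
    [ChartedSpace (ParaSasaki.Coord (2 * n + 1)) M] [IsManifold (𝓡 (2 * n + 1)) ∞ M]
    (A : ParaSasaki.AlmostParacontactMetric n M) (hA : ParaSasaki.IsParaSasakian A)
    (f lam mu p : M → ℝ)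
    (hsol : ParaSasaki.IsGradientAlmostConformalEtaRicciSoliton A f lam mu p) :
    (∀ x, mu x = 0) ∧
    ParaSasaki.IsGradientAlmostConformalRicciSoliton A f lam p ∧
    ∀ c : M, ∀ y ∈ ParaSasaki.chartDomain (m := 2 * n + 1) c,
      (∀ u v, ParaSasaki.ricci (ParaSasaki.readBilin c A.g) y u v
        = -(2 * (n : ℝ)) * ParaSasaki.readBilin c A.g y u v) ∧
      (∀ u, ParaSasaki.ricciOp (ParaSasaki.readBilin c A.g) y u = -(2 * (n : ℝ)) • u) ∧
      ParaSasaki.scalarCurvature (ParaSasaki.readBilin c A.g) y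
        = -(2 * (n : ℝ)) * (2 * (n : ℝ) + 1) := by
  have hmu := hsol.mu_eq_zero (by omega) hA
  refine ⟨hmu, ⟨hsol.smooth_f, hsol.smooth_lam, hsol.smooth_p, hsol.nonzero, fun c y hy u v => ?_⟩,
    fun c y hy => ?_⟩
  · have := hsol.equation c y hy u v
    rw [ParaSasaki.readFun, ParaSasaki.readFun, ParaSasaki.readFun, hmu] at this
    simpa [ParaSasaki.readFun] using this
  · have h := hA.isParaSasakianOn c
    have hric : ∀ u v, ParaSasaki.ricci (ParaSasaki.readBilin c A.g) y u v
        = -(2 * (n : ℝ)) * ParaSasaki.readBilin c A.g y u v := by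
      intro u v
      rw [(hsol.isSolitonOn c).ricci_eq h (by omega) hy, ParaSasaki.readFun, hmu]
      push_cast
      ring
    have hop := ParaSasaki.ricciOp_eq_of_ricci h.toIsMetricOn hy hric
    refine ⟨hric, hop, ?_⟩
    rw [ParaSasaki.scalarCurvature_eq_of_ricciOp hop]
    push_cast
    ring
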